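/- Model. A list consists of $m\ge 2$ finite sets $A_1,\dots,A_m$ (over an arbitrary universe), real numbers $m_1,\dots,m_m$, and a random generator for each $A_i$. For $\alpha_L,\alpha_R,\beta_L,\beta_R\in[0,1)$ it is called an $((\alpha_L,\alpha_R),(\beta_L,\beta_R))$-list if, for every $i$, $(1-\beta_L)|A_i|\le m_i\le(1+\beta_R)|A_i|$, and the generator of $A_i$ returns an element of $A_i$, each $x\in A_i$ being returned with probability in $\left[\frac{1-\alpha_L}{|A_i|},\frac{1+\alpha_R}{|A_i|}\right]$. An algorithm is a finite program for a randomized real RAM at unit cost (addition, subtraction and comparison of natural numbers, which serve as addresses; field operations, $\exp$, $\log$ and comparisons of real numbers, without rounding; rational constants; tests and counted loops, each pass being charged; coins of prescribed bias and uniform random integers). Its input is $m$, $\epsilon$, $\gamma$, $M=m_1+\dots+m_m$ and $m_1,\dots,m_m$; it is not given $\alpha_L,\alpha_R,\beta_L,\beta_R$. It accesses the sets only by requests for a random element of $A_i$ and by membership queries ``$x\in A_i$?'' for elements $x$ it has received. In one round it sends any number of requests, fixed before any answer of that round is known, and receives all answers; random answers are independent. The time is the number of elementary steps, each request counting as a step;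 the round complexity is the number of rounds. Theorem. There are a polynomial $P$ in two variables and a constant $B$ such that for every real $\xi>0$ there are an algorithm and a constant $C$ (which may depend on $\xi$) with the following property. For all $m\ge 2$, all $\alpha_L,\alpha_R,\beta_L,\beta_R\in[0,1)$, every $((\alpha_L,\alpha_R),(\beta_L,\beta_R))$-list $A_1,\dots,A_m$ and all $\epsilon,\gamma\in(0,1)$, every run of the algorithm takes time at most $$C\cdot P\!\left(\tfrac1\epsilon,\ \log\tfrac1\gamma\right)\cdot m^{1+\xi}$$ and at most $B\cdot\max\left(1,\tfrac1\xi\right)$ rounds, and with probability at least $1-\gamma$ its output lies in $$\left[(1-\epsilon)(1-\alpha_L)(1-\beta_L)\,|A_1\cup\dots\cup A_m|,\ (1+\epsilon)(1+\alpha_R)(1+\beta_R)\,|A_1\cup\dots\cup A_m|\right].$$ -/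

import Mathlib

noncomputable section

namespace SetUnion

/-! ## The input: a list of sets with approximate sizes and biased random generators -/

/-- A list of `m` finite sets, each with a number (the approximate size announced for it) and with
the output distribution of its random generator. -/
structure SetList (E : Type*) (m : ℕ) where
  /-- the set `A_i` -/
  set : Fin m → Finset E
  /-- the announced size `m_i` -/
  size : Fin m → ℝ
  /-- the distribution of the random element that the generator of `A_i` returns -/
  gen : Fin m → PMF E

/-- `p` is the output distribution of an `(αL, αR)`-biased random generator for the set `A`: it
returns elements of `A`, each with probability in `[(1 - αL) / |A|, (1 + αR) / |A|]`. -/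
def IsBiasedGenerator {E : Type*} (A : Finset E) (αL αR : ℝ) (p : PMF E) : Prop :=
  (∀ x ∉ A, p x = 0) ∧
    ∀ x ∈ A, (1 - αL) / (A.card : ℝ) ≤ (p x).toReal ∧ (p x).toReal ≤ (1 + αR) / (A.card : ℝ)

/-- `L` is an `((αL, αR), (βL, βR))`-list. -/
def SetList.IsBiasedList {E : Type*} {m : ℕ} (L : SetList E m) (αL αR βL βR : ℝ) : Prop :=
  ∀ i : Fin m,
    (1 - βL) * ((L.set i).card : ℝ) ≤ L.size i ∧
    L.size i ≤ (1 + βR) * ((L.set i).card : ℝ) ∧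
    IsBiasedGenerator (L.set i) αL αR (L.gen i)

/-- The size of the union `|A_1 ∪ ⋯ ∪ A_m|`. -/
def SetList.unionSize {E : Type*} {m : ℕ} (L : SetList E m) : ℕ :=
  (⋃ i : Fin m, (L.set i : Set E)).ncard

/-- `M = m_1 + ⋯ + m_m`. -/
def SetList.totalSize {E : Type*} {m : ℕ} (L : SetList E m) : ℝ :=
  ∑ i : Fin m, L.size i

/-! ## The machine: a randomized real RAM that talks to the sets in rounds

A program is a finite syntactic object that knows neither the sets nor their number.  The server
has three kinds of memory cells: natural numbers, real numbers, and elements of the sets.  Each kind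
is organized as arrays `a[0], a[1], …`, one for every name `a : ℕ`.  Elements are opaque: they can
only be received from a generator, copied, and sent to a set in a membership query.  Natural numbers
can be added, subtracted and compared and serve as addresses.  Real numbers admit the field
operations, `exp`, `log` and comparisons, but no rounding. -/

/-- Expressions with natural-number values. -/
inductive NExp : Type
  | const (n : ℕ)
  | get (a : ℕ) (i : NExp)
  | add (e f : NExp)
  | sub (e f : NExp)

/-- Expressions with real values; the constants in a program are rational. -/
inductive RExp : Type
  | const (q : ℚ)
  | get (a : ℕ) (i : NExp)
  | ofNat (e : NExp)
  | add (e f : RExp)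
  | sub (e f : RExp)
  | mul (e f : RExp)
  | div (e f : RExp)
  | exp (e : RExp)
  | log (e : RExp)

/-- Tests. -/
inductive Test : Type
  | natLe (e f : NExp)
  | realLe (e f : RExp)

/-- Programs. -/
inductive Prog : Type
  /-- do nothing -/
  | skip
  /-- natural-number cell `a[i] := e` -/
  | setNat (a : ℕ) (i : NExp) (e : NExp)
  /-- real cell `a[i] := e` -/
  | setReal (a : ℕ) (i : NExp) (e : RExp)
  /-- element cell `a[i] :=` element cell `b[j]` -/
  | copyElem (a : ℕ) (i : NExp) (b : ℕ) (j : NExp)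
  /-- natural-number cell `a[i] := 1` with probability `p` and `0` otherwise -/
  | coin (a : ℕ) (i : NExp) (p : RExp)
  /-- natural-number cell `a[i] :=` a uniformly random element of `{0, …, n - 1}` -/
  | rand (a : ℕ) (i : NExp) (n : NExp)
  /-- issue the request "random element of set number `k`", answer to element cell `a[i]` -/
  | askElem (a : ℕ) (i : NExp) (k : NExp)
  /-- issue the request "is the element in cell `b[j]` in set number `k`?", answer (`1` or `0`) to
  natural-number cell `a[i]` -/
  | askMem (a : ℕ) (i : NExp) (b : ℕ) (j : NExp) (k : NExp)
  /-- one round: send all outstanding requests and receive all answers -/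
  | round
  /-- sequential composition -/
  | seq (c d : Prog)
  /-- branching -/
  | ite (t : Test) (c d : Prog)
  /-- `for k = 0, 1, 2, …` as long as `k < r`: store `k` in natural-number cell `x[0]`, run `c`
  (`r` is evaluated once, on entry) -/
  | loop (x : ℕ) (r : RExp) (c : Prog)

/-- Requests that have been issued and not yet been sent, with the address of the answer. -/
inductive Request (E : Type*)
  | elem (a i k : ℕ)
  | mem (a i : ℕ) (x : Option E) (k : ℕ)

/-- The state of the machine. -/
structure State (E : Type*) where
  /-- natural-number cells -/
  nat : ℕ → ℕ → ℕ
  /-- real cells -/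
  real : ℕ → ℕ → ℝ
  /-- element cells (`none`: empty) -/
  elem : ℕ → ℕ → Option E
  /-- outstanding requests -/
  pending : List (Request E)
  /-- number of steps so far -/
  time : ℕ
  /-- number of rounds so far -/
  rounds : ℕ

/-- Overwrite cell `a[i]` by `v`. -/
def write {β : Type*} (μ : ℕ → ℕ → β) (a i : ℕ) (v : β) : ℕ → ℕ → β :=
  Function.update μ a (Function.update (μ a) i v)

namespace State

variable {E : Type*}

/-- Charge `n` steps. -/
def tick (s : State E) (n : ℕ) : State E := { s with time := s.time + n }

/-- Store a natural number. -/
def putNat (s : State E) (a i v : ℕ) : State E := { s with nat := write s.nat a i v }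

/-- Store a real number. -/
def putReal (s : State E) (a i : ℕ) (v : ℝ) : State E := { s with real := write s.real a i v }

/-- Store an element. -/
def putElem (s : State E) (a i : ℕ) (v : Option E) : State E :=
  { s with elem := write s.elem a i v }

/-- Issue a request. -/
def issue (s : State E) (q : Request E) : State E := { s with pending := s.pending ++ [q] }

end State

/-- Value of a natural-number expression. -/
def NExp.eval {E : Type*} (s : State E) : NExp → ℕ
  | .const n => n
  | .get a i => s.nat a (i.eval s)
  | .add e f => e.eval s + f.eval s
  | .sub e f => e.eval s - f.eval s

/-- Cost of evaluation: the number of constants, reads and operations. -/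
def NExp.cost : NExp → ℕ
  | .const _ => 1
  | .get _ i => i.cost + 1
  | .add e f => e.cost + f.cost + 1
  | .sub e f => e.cost + f.cost + 1

/-- Value of a real expression. -/
def RExp.eval {E : Type*} (s : State E) : RExp → ℝ
  | .const q => (q : ℝ)
  | .get a i => s.real a (i.eval s)
  | .ofNat e => (e.eval s : ℝ)
  | .add e f => e.eval s + f.eval s
  | .sub e f => e.eval s - f.eval s
  | .mul e f => e.eval s * f.eval s
  | .div e f => e.eval s / f.eval s
  | .exp e => Real.exp (e.eval s)
  | .log e => Real.log (e.eval s)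

/-- Cost of evaluation: the number of constants, reads and operations. -/
def RExp.cost : RExp → ℕ
  | .const _ => 1
  | .get _ i => i.cost + 1
  | .ofNat e => e.cost + 1
  | .add e f => e.cost + f.cost + 1
  | .sub e f => e.cost + f.cost + 1
  | .mul e f => e.cost + f.cost + 1
  | .div e f => e.cost + f.cost + 1
  | .exp e => e.cost + 1
  | .log e => e.cost + 1

/-- Outcome of a test. -/
def Test.Holds {E : Type*} (s : State E) : Test → Prop
  | .natLe e f => e.eval s ≤ f.eval s
  | .realLe e f => e.eval s ≤ f.eval s

/-- Cost of a test. -/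
def Test.cost : Test → ℕ
  | .natLe e f => e.cost + f.cost + 1
  | .realLe e f => e.cost + f.cost + 1

/-- A coin that shows `1` with probability `p` (with `0` if `p ≤ 0` and with `1` if `p ≥ 1`) and
`0` otherwise. -/
def coinDist (p : ℝ) : PMF ℕ :=
  (PMF.ofFintype
    (fun b : Bool => if b then ENNReal.ofReal (min p 1) else 1 - ENNReal.ofReal (min p 1))
    (by simp)).map fun b => if b then 1 else 0

open Classical in
/-- A uniformly random element of `{0, …, n - 1}` (the number `0` if `n = 0`). -/
def randDist (n : ℕ) : PMF ℕ :=
  if h : n = 0 then PMF.pure 0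
  else PMF.uniformOfFinset (Finset.range n) (Finset.nonempty_range_iff.mpr h)

open Classical in
/-- The effect of the answer to one request.  The sets are numbered `0, …, m - 1`; there is nobody
to answer a request to another number. -/
def answer {E : Type*} {m : ℕ} (L : SetList E m) (s : State E) : Request E → PMF (State E)
  | .elem a i k =>
      if h : k < m then (L.gen ⟨k, h⟩).map fun x => s.putElem a i (some x) else PMF.pure s
  | .mem a i x k =>
      if h : k < m then
        PMF.pure (s.putNat a i (if ∃ y ∈ L.set ⟨k, h⟩, x = some y then 1 else 0))
      else PMF.pure s

/-- The answers to a list of requests; the generators are called independently. -/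
def answerAll {E : Type*} {m : ℕ} (L : SetList E m) : List (Request E) → State E → PMF (State E)
  | [], s => PMF.pure s
  | q :: qs, s => (answer L s q).bind (answerAll L qs)

/-- `f 0`, then `f 1`, …, then `f (n - 1)`. -/
def iter {σ : Type*} (f : ℕ → σ → PMF σ) : ℕ → σ → PMF σ
  | 0, s => PMF.pure s
  | n + 1, s => (iter f n s).bind (f n)

open Classical in
/-- The distribution of the final state when a program runs on the list `L` from the state `s`.
Every instruction costs one step and the evaluation of its operands, every request is charged
when it is issued and again when it is answered, and every pass through a loop costs one step
on top of its body.  In particular an answer is not available before the round in which its request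
is sent, so that the requests of one round do not depend on each other's answers. -/
def Prog.run {E : Type*} {m : ℕ} (L : SetList E m) : Prog → State E → PMF (State E)
  | .skip, s => PMF.pure (s.tick 1)
  | .setNat a i e, s =>
      PMF.pure ((s.putNat a (i.eval s) (e.eval s)).tick (i.cost + e.cost + 1))
  | .setReal a i e, s =>
      PMF.pure ((s.putReal a (i.eval s) (e.eval s)).tick (i.cost + e.cost + 1))
  | .copyElem a i b j, s =>
      PMF.pure ((s.putElem a (i.eval s) (s.elem b (j.eval s))).tick (i.cost + j.cost + 1))
  | .coin a i p, s =>
      (coinDist (p.eval s)).map fun v => (s.putNat a (i.eval s) v).tick (i.cost + p.cost + 1)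
  | .rand a i n, s =>
      (randDist (n.eval s)).map fun v => (s.putNat a (i.eval s) v).tick (i.cost + n.cost + 1)
  | .askElem a i k, s =>
      PMF.pure ((s.issue (.elem a (i.eval s) (k.eval s))).tick (i.cost + k.cost + 1))
  | .askMem a i b j k, s =>
      PMF.pure ((s.issue (.mem a (i.eval s) (s.elem b (j.eval s)) (k.eval s))).tick
        (i.cost + j.cost + k.cost + 1))
  | .round, s =>
      answerAll L s.pending
        { s with
          pending := []
          time := s.time + s.pending.length + 1
          rounds := s.rounds + 1 }
  | .seq c d, s => (c.run L s).bind (d.run L)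
  | .ite t c d, s =>
      if t.Holds s then c.run L (s.tick (t.cost + 1)) else d.run L (s.tick (t.cost + 1))
  | .loop x r c, s =>
      iter (fun k s' => c.run L ((s'.putNat x 0 k).tick 1)) ⌈r.eval s⌉₊ (s.tick (r.cost + 1))

/-- The initial state.  Natural-number cell `0[0]` holds `m`; real cells `0[0]`, `0[1]`, `0[2]` hold
`ε`, `γ` and `M = m_1 + ⋯ + m_m`; real cells `1[0], …, 1[m - 1]` hold the announced sizes; all other
cells are zero or empty. -/
def initial {E : Type*} {m : ℕ} (L : SetList E m) (ε γ : ℝ) : State E where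
  nat := fun a i => if a = 0 ∧ i = 0 then m else 0
  real := fun a i =>
    if a = 0 then (if i = 0 then ε else if i = 1 then γ else if i = 2 then L.totalSize else 0)
    else if a = 1 then (if h : i < m then L.size ⟨i, h⟩ else 0)
    else 0
  elem := fun _ _ => none
  pending := []
  time := 0
  rounds := 0

/-- The output of the machine is what real cell `0[0]` holds at the end. -/
def State.output {E : Type*} (s : State E) : ℝ := s.real 0 0

/-- The distribution of the final state on input `L`, `ε`, `γ`. -/
def Prog.final {E : Type*} {m : ℕ} (c : Prog) (L : SetList E m) (ε γ : ℝ) : PMF (State E) :=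
  c.run L (initial L ε γ)

end SetUnion

end

noncomputable section

namespace SetUnion

open scoped ENNReal

/-! Arrange the sets in a cycle. For `x ∈ A_i` let the gap of `(x, i)` be the number of steps from
`i` to the next set that contains `x`. For fixed `x` the gaps of its owners fill the cycle, so they
add up to `m` (`sum_gap`). Hence the sum over all `i` of `m_i` times the mean of gap`/m`, for `x`
drawn from `A_i`, is the union size when sizes and generators are exact. In general `m_i` times the
probability of `x` lies between `(1-αL)(1-βL)` and `(1+αR)(1+βR)`, which gives exactly the bias
allowed (`mean_bounds`). It remains to estimate `L.mean` with relative error `ε`.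

Draw about `R` samples, an expected `R m_i / M` of them from `A_i`, with `R` of order `m` up to
factors in `ε`, `γ` and `K`. Since gap`/m` lies in `[1/m, 1]`, their sum has mean at least `R/m`,
and a Chernoff bound applies (`draw_run`). Finding every gap by brute force could take about `R m`
queries. Therefore the gaps are explored in stages with `ρ = m^(1/K)`. Before stage `k` every
surviving sample has gap at least `ρ^k`, so about `R/ρ^k` uniformly resampled survivors suffice: the
mean of their sum of gap`/m` is again at least `R/m`. Each is tested against the next `⌈ρ^(k+1)⌉`
sets. Gaps found within this range are added to the total with the current weight; the other samples
survive. A stage costs `O(Rρ)` whatever `k` is (`stage_time_bound`) and takes one round, since its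
queries are fixed in advance.

The quantity followed is `State.potential`, the estimate that would result if all remaining gaps
were known. Sorting the samples does not change it, and resampling changes it by a factor in `[1-η,
1+η]` up to a small failure probability (`stage_run`). After `K+1` stages a survivor would have gap
at least `mρ > m`, so none is left and the potential is the output (`main_run`). With `K = ⌈1/ξ⌉`
the time is `O(m^(1+ξ))` and there are `K+2` rounds. -/

/-! ## Expectations and failure probabilities for probability mass functions -/

/-- The expectation of a nonnegative function. -/
def pexp {σ : Type*} (p : PMF σ) (f : σ → ℝ≥0∞) : ℝ≥0∞ := ∑' a, p a * f a

/-- `Q` holds on the whole support of `p`. -/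
def Sure {σ : Type*} (p : PMF σ) (Q : σ → Prop) : Prop := ∀ a ∈ p.support, Q a

/-- `Q` fails with probability at most `δ`. -/
def Fails {σ : Type*} (p : PMF σ) (Q : σ → Prop) (δ : ℝ≥0∞) : Prop :=
  p.toOuterMeasure {a | ¬ Q a} ≤ δ

section Expectation

variable {σ τ : Type*}

lemma pexp_pure (a : σ) (f : σ → ℝ≥0∞) : pexp (PMF.pure a) f = f a := by
  unfold pexp
  rw [tsum_eq_single a]
  · simp
  · intro b hb
    simp [PMF.pure_apply, hb]

lemma pexp_bind (p : PMF σ) (q : σ → PMF τ) (f : τ → ℝ≥0∞) :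
    pexp (p.bind q) f = pexp p fun a => pexp (q a) f := by
  unfold pexp
  simp only [PMF.bind_apply, ← ENNReal.tsum_mul_right, ← ENNReal.tsum_mul_left]
  rw [ENNReal.tsum_comm]
  simp only [mul_assoc]

lemma pexp_map (p : PMF σ) (g : σ → τ) (f : τ → ℝ≥0∞) :
    pexp (p.map g) f = pexp p fun a => f (g a) := by
  rw [← PMF.bind_pure_comp, pexp_bind]
  simp [pexp_pure]

lemma pexp_mono {p : PMF σ} {f g : σ → ℝ≥0∞} (h : Sure p fun a => f a ≤ g a) :
    pexp p f ≤ pexp p g := by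
  refine ENNReal.tsum_le_tsum fun a => ?_
  by_cases ha : a ∈ p.support
  · gcongr
    exact h a ha
  · simp [(PMF.apply_eq_zero_iff p a).2 ha]

lemma pexp_const (p : PMF σ) (c : ℝ≥0∞) : pexp p (fun _ => c) = c := by
  simp [pexp, ENNReal.tsum_mul_right]

lemma pexp_const_mul (p : PMF σ) (c : ℝ≥0∞) (f : σ → ℝ≥0∞) :
    pexp p (fun a => c * f a) = c * pexp p f := by
  simp only [pexp, ← ENNReal.tsum_mul_left]
  exact tsum_congr fun a => by ring

lemma pexp_add (p : PMF σ) (f g : σ → ℝ≥0∞) :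
    pexp p (fun a => f a + g a) = pexp p f + pexp p g := by
  simp only [pexp, mul_add, ENNReal.tsum_add]

lemma Sure.mono {p : PMF σ} {Q R : σ → Prop} (h : Sure p Q) (hQR : ∀ a, Q a → R a) : Sure p R :=
  fun a ha => hQR a (h a ha)

lemma sure_pure {a : σ} {Q : σ → Prop} : Sure (PMF.pure a) Q ↔ Q a := by
  simp [Sure]

lemma sure_bind {p : PMF σ} {q : σ → PMF τ} {Q : τ → Prop} :
    Sure (p.bind q) Q ↔ Sure p fun a => Sure (q a) Q := by
  simp only [Sure, PMF.mem_support_bind_iff]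
  exact ⟨fun h a ha b hb => h b ⟨a, ha, hb⟩, fun h b ⟨a, ha, hb⟩ => h a ha b hb⟩

lemma sure_map {p : PMF σ} {g : σ → τ} {Q : τ → Prop} :
    Sure (p.map g) Q ↔ Sure p fun a => Q (g a) := by
  simp [Sure]

lemma sure_iter {f : ℕ → σ → PMF σ} (I : ℕ → σ → Prop) (n : ℕ) (s : σ) (h0 : I 0 s)
    (hstep : ∀ k < n, ∀ a, I k a → Sure (f k a) (I (k + 1))) : Sure (iter f n s) (I n) := by
  induction n with
  | zero => exact sure_pure.2 h0
  | succ n ih =>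
    refine sure_bind.2 ((ih fun k hk => hstep k (hk.trans n.lt_succ_self)).mono ?_)
    exact hstep n n.lt_succ_self

/-- The supermartingale principle for loops: the moment generating functions below are all bounded
by a family `F k` that does not grow in expectation during a pass. -/
lemma pexp_iter {f : ℕ → σ → PMF σ} (I : ℕ → σ → Prop) (F : ℕ → σ → ℝ≥0∞) (n : ℕ) (s : σ)
    (h0 : I 0 s) (hstep : ∀ k < n, ∀ a, I k a → Sure (f k a) (I (k + 1)))
    (hF : ∀ k < n, ∀ a, I k a → pexp (f k a) (F (k + 1)) ≤ F k a) :
    pexp (iter f n s) (F n) ≤ F 0 s := by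
  induction n with
  | zero => exact (pexp_pure _ _).le
  | succ n ih =>
    have hs : ∀ k < n, ∀ a, I k a → Sure (f k a) (I (k + 1)) :=
      fun k hk => hstep k (hk.trans n.lt_succ_self)
    rw [iter, pexp_bind]
    refine (pexp_mono ((sure_iter I n s h0 hs).mono ?_)).trans
      (ih hs fun k hk => hF k (hk.trans n.lt_succ_self))
    exact hF n n.lt_succ_self

lemma toOuterMeasure_eq_pexp (p : PMF σ) (A : Set σ) :
    p.toOuterMeasure A = pexp p (A.indicator fun _ => 1) := by
  classical
  rw [PMF.toOuterMeasure_apply, pexp]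
  refine tsum_congr fun a => ?_
  by_cases h : a ∈ A <;> simp [h]

lemma Sure.fails {p : PMF σ} {Q : σ → Prop} (h : Sure p Q) (δ : ℝ≥0∞) : Fails p Q δ := by
  have : p.toOuterMeasure {a | ¬ Q a} = 0 :=
    (PMF.toOuterMeasure_apply_eq_zero_iff _ _).2
      (Set.disjoint_left.2 fun a ha hn => hn (h a ha))
  simp [Fails, this]

lemma Fails.mono {p : PMF σ} {Q R : σ → Prop} {δ : ℝ≥0∞} (h : Fails p Q δ)
    (hQR : Sure p fun a => Q a → R a) : Fails p R δ :=
  (PMF.toOuterMeasure_mono p (s := {a | ¬ R a}) (t := {a | ¬ Q a})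
    fun a ha hq => ha.1 (hQR a ha.2 hq)).trans h

lemma Fails.weaken {p : PMF σ} {Q : σ → Prop} {δ δ' : ℝ≥0∞} (h : Fails p Q δ) (hδ : δ ≤ δ') :
    Fails p Q δ' := h.trans hδ

lemma fails_map {p : PMF σ} {g : σ → τ} {Q : τ → Prop} {δ : ℝ≥0∞}
    (h : Fails p (fun a => Q (g a)) δ) : Fails (p.map g) Q δ := by
  unfold Fails
  rw [PMF.toOuterMeasure_map_apply]
  exact h

/-- The union bound for consecutive random steps. -/
lemma Fails.bind {p : PMF σ} {q : σ → PMF τ} {Q : σ → Prop} {R : τ → Prop} {δ δ' : ℝ≥0∞}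
    (hp : Fails p Q δ) (hq : ∀ a ∈ p.support, Q a → Fails (q a) R δ') :
    Fails (p.bind q) R (δ + δ') := by
  unfold Fails at *
  rw [toOuterMeasure_eq_pexp, pexp_bind]
  calc _ ≤ pexp p (fun a => {a | ¬ Q a}.indicator (fun _ => 1) a + δ') := by
        refine pexp_mono fun a ha => ?_
        beta_reduce
        rw [← toOuterMeasure_eq_pexp]
        by_cases h : Q a
        · simpa [h] using hq a ha h
        · have h1 : pexp (q a) ({b | ¬ R b}.indicator fun _ => 1) ≤ 1 := by
            refine (pexp_mono (g := fun _ => 1) fun b _ => ?_).trans (pexp_const _ _).le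
            exact Set.indicator_le_self' (by simp) b
          rw [toOuterMeasure_eq_pexp]
          simpa [h] using h1.trans le_self_add
    _ ≤ δ + δ' := by
        rw [pexp_add, pexp_const, ← toOuterMeasure_eq_pexp]
        gcongr

/-- Markov's inequality, with `F` dominating the indicator of failure. -/
lemma fails_of_pexp_le {p : PMF σ} {Q : σ → Prop} {F : σ → ℝ≥0∞} {δ : ℝ≥0∞}
    (hF : Sure p fun a => ¬ Q a → 1 ≤ F a) (h : pexp p F ≤ δ) : Fails p Q δ := by
  unfold Fails
  rw [toOuterMeasure_eq_pexp]
  refine (pexp_mono fun a ha => ?_).trans h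
  by_cases hq : Q a
  · simp [hq]
  · simpa [hq] using hF a ha hq

lemma one_sub_le_of_fails {p : PMF σ} {Q : σ → Prop} {δ : ℝ≥0∞} (h : Fails p Q δ) :
    1 - δ ≤ p.toOuterMeasure {a | Q a} := by
  refine tsub_le_iff_right.2 ?_
  have : p.toOuterMeasure {a | Q a} + p.toOuterMeasure {a | ¬ Q a} = 1 := by
    rw [toOuterMeasure_eq_pexp, toOuterMeasure_eq_pexp, ← pexp_add]
    refine Eq.trans ?_ (pexp_const p 1)
    refine congrArg _ (funext fun a => ?_)
    by_cases hq : Q a <;> simp [hq]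
  rw [← this]
  gcongr
  exact h

end Expectation

/-! ## Chernoff bounds -/

lemma exp_mul_le_one_add (l : ℝ) {x : ℝ} (h0 : 0 ≤ x) (h1 : x ≤ 1) :
    Real.exp (l * x) ≤ 1 + (Real.exp l - 1) * x := by
  have := convexOn_exp.2 (Set.mem_univ 0) (Set.mem_univ l) (sub_nonneg.2 h1) h0 (by ring)
  simp only [smul_eq_mul, mul_zero, zero_add, Real.exp_zero] at this
  rw [mul_comm l x]
  linarith

lemma exp_sub_one_le {l : ℝ} (h : |l| ≤ 1) : Real.exp l - 1 ≤ l + l ^ 2 := by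
  have := (abs_le.1 (Real.abs_exp_sub_one_sub_id_le h)).2
  linarith

/-- If the moment generating function of `X` is bounded like that of a sum of independent
`[0, 1]`-valued variables with mean `μ`, then `X` is concentrated around `μ`. -/
lemma fails_of_mgf {σ : Type*} (p : PMF σ) (X : σ → ℝ) (μ η : ℝ) (h0 : 0 ≤ μ)
    (hη0 : 0 < η) (hη1 : η ≤ 1)
    (h : ∀ l : ℝ, pexp p (fun a => ENNReal.ofReal (Real.exp (l * X a))) ≤
      ENNReal.ofReal (Real.exp ((Real.exp l - 1) * μ))) :
    Fails p (fun a => |X a - μ| ≤ η * μ)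
      (ENNReal.ofReal (2 * Real.exp (-(η ^ 2 * μ / 4)))) := by
  have tail : ∀ l c : ℝ, |l| ≤ 1 → (l + l ^ 2) * μ + c ≤ -(η ^ 2 * μ / 4) →
      pexp p (fun a => ENNReal.ofReal (Real.exp (l * X a + c))) ≤
        ENNReal.ofReal (Real.exp (-(η ^ 2 * μ / 4))) := by
    intro l c hl hc
    have : (fun a => ENNReal.ofReal (Real.exp (l * X a + c))) =
        fun a => ENNReal.ofReal (Real.exp c) * ENNReal.ofReal (Real.exp (l * X a)) := by
      funext a
      rw [← ENNReal.ofReal_mul (Real.exp_nonneg _), ← Real.exp_add, add_comm]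
    rw [this, pexp_const_mul]
    refine (mul_le_mul_right (h l) _).trans ?_
    rw [← ENNReal.ofReal_mul (Real.exp_nonneg _), ← Real.exp_add]
    refine ENNReal.ofReal_le_ofReal (Real.exp_le_exp.2 ?_)
    have := mul_le_mul_of_nonneg_right (exp_sub_one_le hl) h0
    linarith
  -- The two tails use `l = η/2` and `l = -η/2`. With `exp l - 1 ≤ l + l²` both exponents become
  -- exactly `-η²μ/4`.
  refine fails_of_pexp_le (F := fun a =>
    ENNReal.ofReal (Real.exp (η / 2 * X a + -(η / 2 * (1 + η) * μ))) +
      ENNReal.ofReal (Real.exp (-(η / 2) * X a + η / 2 * (1 - η) * μ))) ?_ ?_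
  · intro a _ ha
    have one_le : ∀ x : ℝ, 0 ≤ x → 1 ≤ ENNReal.ofReal (Real.exp x) := fun x hx => by
      rw [← ENNReal.ofReal_one]
      exact ENNReal.ofReal_le_ofReal (Real.one_le_exp hx)
    rw [not_le, lt_abs] at ha
    rcases ha with ha | ha
    · refine (one_le _ ?_).trans le_self_add
      nlinarith
    · refine (one_le _ ?_).trans le_add_self
      nlinarith
  · rw [pexp_add, two_mul, ENNReal.ofReal_add (Real.exp_nonneg _) (Real.exp_nonneg _)]
    refine add_le_add (tail _ _ ?_ ?_) (tail _ _ ?_ ?_)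
    · rw [abs_of_pos (by linarith)]; linarith
    · nlinarith
    · rw [abs_neg, abs_of_pos (by linarith)]; linarith
    · nlinarith

/-- The moment generating function of a `[0, 1]`-valued variable. -/
lemma pexp_exp_le {σ : Type*} (p : PMF σ) (A : Finset σ) (hA : ∀ x ∉ A, p x = 0) (X : σ → ℝ)
    (h0 : ∀ x ∈ A, 0 ≤ X x) (h1 : ∀ x ∈ A, X x ≤ 1) (l : ℝ) :
    pexp p (fun x => ENNReal.ofReal (Real.exp (l * X x))) ≤
      ENNReal.ofReal (1 + (Real.exp l - 1) * ∑ x ∈ A, (p x).toReal * X x) := by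
  have hsum : ∑ x ∈ A, (p x).toReal = 1 := by
    have := p.tsum_coe
    rw [tsum_eq_sum (s := A) fun x hx => hA x hx] at this
    rw [← ENNReal.toReal_sum fun x _ => p.apply_ne_top x, this, ENNReal.toReal_one]
  unfold pexp
  rw [tsum_eq_sum (s := A) fun x hx => by rw [hA x hx, zero_mul]]
  calc _ = ∑ x ∈ A, ENNReal.ofReal ((p x).toReal * Real.exp (l * X x)) := by
        refine Finset.sum_congr rfl fun x _ => ?_
        rw [ENNReal.ofReal_mul ENNReal.toReal_nonneg, ENNReal.ofReal_toReal (p.apply_ne_top x)]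
    _ = ENNReal.ofReal (∑ x ∈ A, (p x).toReal * Real.exp (l * X x)) := by
        rw [ENNReal.ofReal_sum_of_nonneg]
        intro x _
        positivity
    _ ≤ _ := by
        refine ENNReal.ofReal_le_ofReal ?_
        -- Writing the leading `1` as the sum of the probabilities makes the inequality termwise;
        -- the `1` in `exp l - 1` is expanded as well and is restored by the next rewrite.
        conv_rhs => rw [← hsum, Finset.mul_sum, ← Finset.sum_add_distrib]
        rw [hsum]
        refine Finset.sum_le_sum fun x hx => ?_
        have := mul_le_mul_of_nonneg_left (exp_mul_le_one_add l (h0 x hx) (h1 x hx))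
          (ENNReal.toReal_nonneg (a := p x))
        linarith

lemma pexp_coinDist (p : ℝ) (f : ℕ → ℝ≥0∞) :
    pexp (coinDist p) f =
      ENNReal.ofReal (min p 1) * f 1 + (1 - ENNReal.ofReal (min p 1)) * f 0 := by
  rw [coinDist, pexp_map, pexp, tsum_fintype]
  simp

lemma sure_coinDist (p : ℝ) : Sure (coinDist p) fun v => v = 0 ∨ v = 1 := by
  rw [coinDist, sure_map]
  intro b _
  cases b <;> simp

lemma sure_randDist {n : ℕ} (hn : 0 < n) : Sure (randDist n) fun v => v < n := by
  intro v hv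
  rw [randDist, dif_neg hn.ne'] at hv
  simpa using hv

lemma randDist_apply {n : ℕ} (hn : 0 < n) {v : ℕ} (hv : v < n) :
    (randDist n v).toReal = (n : ℝ)⁻¹ := by
  rw [randDist, dif_neg hn.ne', PMF.uniformOfFinset_apply_of_mem _ (by simpa using hv)]
  simp

/-! ## Cyclic gaps between the owners of an element -/

section Gap

variable {m : ℕ} [NeZero m]

/-- The number of cyclic steps from `i` to the next index that satisfies `o`. -/
def gap (o : Fin m → Prop) (i : Fin m) : ℕ := sInf {d | 1 ≤ d ∧ o (Fin.ofNat m (i + d))}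

lemma ofNat_val_add (i : Fin m) (d : ℕ) : Fin.ofNat m (i + d) = i + Fin.ofNat m d := by
  ext
  simp [Fin.val_add]

lemma ofNat_add_ofNat (d e : ℕ) : Fin.ofNat m d + Fin.ofNat m e = Fin.ofNat m (d + e) := by
  ext
  simp [Fin.val_add]

lemma ofNat_val_add_self (i : Fin m) : Fin.ofNat m (i + m) = i := by
  ext
  simp [Nat.mod_eq_of_lt i.2]

lemma gap_mem {o : Fin m → Prop} (h : ∃ j, o j) (i : Fin m) :
    1 ≤ gap o i ∧ o (Fin.ofNat m (i + gap o i)) := by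
  obtain ⟨j, hj⟩ := h
  -- A full turn is added so that the distance is positive even when `j = i`.
  refine Nat.sInf_mem (s := {d | 1 ≤ d ∧ o (Fin.ofNat m (i + d))}) ⟨(j - i : Fin m) + m, ?_, ?_⟩
  · have := NeZero.pos m
    omega
  · rw [ofNat_val_add, ofNat_val_add_self]
    simpa using hj

lemma lt_gap_iff {o : Fin m → Prop} (h : ∃ j, o j) (i : Fin m) (d : ℕ) :
    d < gap o i ↔ ∀ e, 1 ≤ e → e ≤ d → ¬ o (Fin.ofNat m (i + e)) := by
  refine ⟨fun hd e h1 he ho => ?_, fun hd => ?_⟩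
  · exact absurd (Nat.sInf_le (show e ∈ {d | 1 ≤ d ∧ o (Fin.ofNat m (i + d))} from ⟨h1, ho⟩))
      (not_le.2 (he.trans_lt hd))
  · by_contra hlt
    exact hd _ (gap_mem h i).1 (not_lt.1 hlt) (gap_mem h i).2

lemma gap_le {o : Fin m → Prop} {i : Fin m} (h : o i) : gap o i ≤ m :=
  Nat.sInf_le ⟨NeZero.pos m, by rwa [ofNat_val_add_self]⟩

/-- The recursion that `Program.tally` carries out: one more negative answer is needed for the gap
to exceed one more step. -/
lemma succ_lt_gap_iff {o : Fin m → Prop} (h : ∃ j, o j) (i : Fin m) (d : ℕ) :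
    d + 1 < gap o i ↔ d < gap o i ∧ ¬ o (Fin.ofNat m (i + (d + 1))) := by
  rw [lt_gap_iff h, lt_gap_iff h]
  refine ⟨fun H => ⟨fun e h1 he => H e h1 (by omega), H _ (by omega) le_rfl⟩, fun H e h1 he => ?_⟩
  rcases Nat.lt_or_ge d e with hd | hd
  · obtain rfl : e = d + 1 := by omega
    exact H.2
  · exact H.1 e h1 hd

open Classical in
/-- The gaps of the owners fill the whole cycle. -/
lemma sum_gap {o : Fin m → Prop} (h : ∃ j, o j) :
    ∑ i : Fin m, (if o i then gap o i else 0) = m := by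
  have h1 : ∀ i : Fin m, (if o i then gap o i else 0) =
      ∑ d ∈ Finset.range m, if o i ∧ d < gap o i then 1 else 0 := by
    intro i
    by_cases hi : o i
    · have := gap_le hi
      simp only [hi, if_true, true_and, Finset.sum_boole, Nat.cast_id]
      have : (Finset.range m).filter (fun d => d < gap o i) = Finset.range (gap o i) := by
        ext d
        simp only [Finset.mem_filter, Finset.mem_range]
        omega
      rw [this, Finset.card_range]
    · simp [hi]
  -- Each position `p` lies in the arc of exactly one owner, namely the first one met when walking
  -- backwards from `p`; `Nat.find hex` is its distance. An owner further back has its arc cut off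
  -- by this one.
  have h2 : ∀ p : Fin m, ∑ d ∈ Finset.range m,
      (if o (p - Fin.ofNat m d) ∧ d < gap o (p - Fin.ofNat m d) then 1 else 0) = 1 := by
    intro p
    have hex : ∃ d, o (p - Fin.ofNat m d) := by
      obtain ⟨j, hj⟩ := h
      refine ⟨(p - j : Fin m), ?_⟩
      have : Fin.ofNat m ((p - j : Fin m) : ℕ) = p - j := by
        ext
        simp
      rw [this]
      simpa using hj
    have hlt : Nat.find hex < m := by
      have h0 := Nat.find_spec hex
      have : Fin.ofNat m (Nat.find hex % m) = Fin.ofNat m (Nat.find hex) := by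
        ext
        simp
      rw [← this] at h0
      exact (Nat.find_min' hex h0).trans_lt (Nat.mod_lt _ (NeZero.pos m))
    rw [Finset.sum_eq_single_of_mem (Nat.find hex) (Finset.mem_range.2 hlt)]
    · rw [if_pos]
      refine ⟨Nat.find_spec hex, (lt_gap_iff h _ _).2 fun e h1 he => ?_⟩
      have : Fin.ofNat m (((p - Fin.ofNat m (Nat.find hex) : Fin m) : ℕ) + e) =
          p - Fin.ofNat m (Nat.find hex - e) := by
        rw [ofNat_val_add]
        have := ofNat_add_ofNat (m := m) (Nat.find hex - e) e
        rw [Nat.sub_add_cancel he] at this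
        rw [← this]
        abel
      rw [this]
      exact Nat.find_min hex (by omega)
    · intro d _ hd
      rw [if_neg]
      rintro ⟨hod, hdg⟩
      have hle := Nat.find_min' hex hod
      refine (lt_gap_iff h _ _).1 hdg (d - Nat.find hex) (by omega) (by omega) ?_
      have : Fin.ofNat m (((p - Fin.ofNat m d : Fin m) : ℕ) + (d - Nat.find hex)) =
          p - Fin.ofNat m (Nat.find hex) := by
        rw [ofNat_val_add]
        have := ofNat_add_ofNat (m := m) (Nat.find hex) (d - Nat.find hex)
        rw [Nat.add_sub_cancel' hle] at this
        rw [← this]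
        abel
      rw [this]
      exact Nat.find_spec hex
  simp_rw [h1]
  rw [Finset.sum_comm]
  -- Double counting of the pairs (owner `i`, offset `d` below its gap) by the position `p = i + d`
  -- that they cover.
  calc _ = ∑ d ∈ Finset.range m, ∑ p : Fin m,
        (if o (p - Fin.ofNat m d) ∧ d < gap o (p - Fin.ofNat m d) then 1 else 0) :=
        Finset.sum_congr rfl fun d _ =>
          ((Equiv.subRight (Fin.ofNat m d)).sum_comp
            fun i => if o i ∧ d < gap o i then 1 else 0).symm
    _ = ∑ p : Fin m, 1 := by
        rw [Finset.sum_comm]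
        exact Finset.sum_congr rfl fun p _ => h2 p
    _ = m := by simp

end Gap

/-! ## The mean of the estimator -/

section Mean

variable {E : Type*} {m : ℕ} (L : SetList E m)

/-- The element in a cell belongs to set number `i`. -/
def SetList.Owner (x : Option E) (i : Fin m) : Prop := ∃ y ∈ L.set i, x = some y

lemma SetList.owner_some {x : E} {i : Fin m} : L.Owner (some x) i ↔ x ∈ L.set i := by
  simp [SetList.Owner]

variable {L} {αL αR βL βR : ℝ}

lemma sum_gen_eq_one (h : L.IsBiasedList αL αR βL βR) (i : Fin m) :
    ∑ x ∈ L.set i, (L.gen i x).toReal = 1 := by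
  have := (L.gen i).tsum_coe
  rw [tsum_eq_sum (s := L.set i) fun x hx => (h i).2.2.1 x hx] at this
  rw [← ENNReal.toReal_sum fun x _ => (L.gen i).apply_ne_top x, this, ENNReal.toReal_one]

/-- The generator is a probability distribution supported on the set, which rules out the empty set.
-/
lemma card_pos_of_isBiasedList (h : L.IsBiasedList αL αR βL βR) (i : Fin m) :
    0 < (L.set i).card := by
  rw [Finset.card_pos]
  by_contra hne
  have := sum_gen_eq_one h i
  rw [Finset.not_nonempty_iff_eq_empty.1 hne] at this
  simp at this

lemma size_pos (h : L.IsBiasedList αL αR βL βR) (hβ : βL < 1) (i : Fin m) : 0 < L.size i := by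
  have := card_pos_of_isBiasedList h i
  have h1 : (0 : ℝ) < (1 - βL) * (L.set i).card := by
    have : (0 : ℝ) < (L.set i).card := by exact_mod_cast this
    have : 0 < 1 - βL := by linarith
    positivity
  exact h1.trans_le (h i).1

/-- The cardinality cancels between announced size and probability. This is the source of the
factors in the final bounds. -/
lemma size_mul_gen_bounds (h : L.IsBiasedList αL αR βL βR) (hα : αL < 1) (hβ : βL < 1)
    (hβR : 0 ≤ βR) {i : Fin m} {x : E} (hx : x ∈ L.set i) :
    (1 - αL) * (1 - βL) ≤ L.size i * (L.gen i x).toReal ∧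
      L.size i * (L.gen i x).toReal ≤ (1 + αR) * (1 + βR) := by
  have hc : (0 : ℝ) < (L.set i).card := by exact_mod_cast card_pos_of_isBiasedList h i
  obtain ⟨h1, h2, _, h3⟩ := h i
  obtain ⟨h3, h4⟩ := h3 x hx
  constructor
  · calc (1 - αL) * (1 - βL) = ((1 - βL) * (L.set i).card) * ((1 - αL) / (L.set i).card) := by
          field_simp
      _ ≤ _ := by
          refine mul_le_mul h1 h3 (div_nonneg (by linarith) hc.le) (size_pos h hβ i).le
  · calc _ ≤ ((1 + βR) * (L.set i).card) * ((1 + αR) / (L.set i).card) :=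
          mul_le_mul h2 h4 ENNReal.toReal_nonneg (by positivity)
      _ = _ := by field_simp

variable [NeZero m] (L)

/-- The number of steps from `i` to the next set that contains the element `x`. -/
def SetList.gap (x : Option E) (i : Fin m) : ℕ := SetUnion.gap (L.Owner x) i

/-- The mean of `gap / m` for a random element of set number `i`. -/
def SetList.drawMean (i : Fin m) : ℝ :=
  ∑ x ∈ L.set i, (L.gen i x).toReal * ((L.gap (some x) i : ℝ) / m)

/-- The mean of the estimator for the size of the union. -/
def SetList.mean : ℝ := ∑ i, L.size i * L.drawMean i

variable {L}

lemma SetList.gap_bounds {x : Option E} {i : Fin m} (h : L.Owner x i) :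
    1 ≤ L.gap x i ∧ L.gap x i ≤ m := ⟨(gap_mem ⟨i, h⟩ i).1, gap_le h⟩

lemma totalSize_pos (h : L.IsBiasedList αL αR βL βR) (hβ : βL < 1) : 0 < L.totalSize :=
  Finset.sum_pos (fun i _ => size_pos h hβ i) ⟨0, Finset.mem_univ _⟩

lemma drawMean_bounds (h : L.IsBiasedList αL αR βL βR) (i : Fin m) :
    1 / (m : ℝ) ≤ L.drawMean i ∧ L.drawMean i ≤ 1 := by
  have hm : (0 : ℝ) < m := by exact_mod_cast NeZero.pos m
  have hs := sum_gen_eq_one h i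
  constructor
  · rw [← mul_one (1 / (m : ℝ)), ← hs, Finset.mul_sum]
    refine Finset.sum_le_sum fun x hx => ?_
    rw [mul_comm]
    refine mul_le_mul_of_nonneg_left ?_ ENNReal.toReal_nonneg
    rw [hs]
    gcongr
    exact_mod_cast (L.gap_bounds ((L.owner_some).2 hx)).1
  · rw [← hs]
    refine Finset.sum_le_sum fun x hx => ?_
    refine mul_le_of_le_one_right ENNReal.toReal_nonneg ?_
    rw [div_le_one hm]
    exact_mod_cast (L.gap_bounds ((L.owner_some).2 hx)).2

/-- Every gap is at least `1`. The bound keeps the mean of the sampled sum above `R/m`, as a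
relative Chernoff bound requires. -/
lemma le_mean (h : L.IsBiasedList αL αR βL βR) (hβ : βL < 1) :
    L.totalSize / m ≤ L.mean := by
  rw [SetList.totalSize, Finset.sum_div]
  refine Finset.sum_le_sum fun i _ => ?_
  have := mul_le_mul_of_nonneg_left (drawMean_bounds h i).1 (size_pos h hβ i).le
  rwa [mul_one_div] at this

open Classical in
lemma mean_bounds (h : L.IsBiasedList αL αR βL βR) (hα : αL < 1) (hβ : βL < 1)
    (hβR : 0 ≤ βR) :
    (1 - αL) * (1 - βL) * L.unionSize ≤ L.mean ∧
      L.mean ≤ (1 + αR) * (1 + βR) * L.unionSize := by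
  have hm : (0 : ℝ) < m := by exact_mod_cast NeZero.pos m
  set U : Finset E := Finset.univ.biUnion L.set with hU
  have hcard : L.unionSize = U.card := by
    rw [SetList.unionSize, ← Set.ncard_coe_finset]
    congr 1
    ext x
    simp [hU]
  have hmean : L.mean = ∑ x ∈ U, ∑ i : Fin m, if x ∈ L.set i then
      L.size i * (L.gen i x).toReal * (L.gap (some x) i : ℝ) / m else 0 := by
    rw [Finset.sum_comm, SetList.mean]
    refine Finset.sum_congr rfl fun i _ => ?_
    rw [← Finset.sum_filter, SetList.drawMean, Finset.mul_sum]
    refine Finset.sum_congr ?_ fun x _ => by ring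
    ext x
    simp only [Finset.mem_filter]
    exact ⟨fun hx => ⟨Finset.mem_biUnion.2 ⟨i, Finset.mem_univ _, hx⟩, hx⟩, fun hx => hx.2⟩
  -- The weights gap`/m` of the owners of `x` add up to `1` by `sum_gap`, so each element of the
  -- union contributes an average of the numbers in `size_mul_gen_bounds`.
  have hone : ∀ x ∈ U, ∀ c : ℝ,
      (∑ i : Fin m, if x ∈ L.set i then c * (L.gap (some x) i : ℝ) / m else 0) = c := by
    intro x hx c
    have hex : ∃ j, L.Owner (some x) j := by
      obtain ⟨i, _, hi⟩ := Finset.mem_biUnion.1 hx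
      exact ⟨i, L.owner_some.2 hi⟩
    have h1 := sum_gap hex
    have h2 : ((∑ i : Fin m, if L.Owner (some x) i then SetUnion.gap (L.Owner (some x)) i else 0 : ℕ)
        : ℝ) = m := by exact_mod_cast h1
    push_cast at h2
    calc _ = c / m * ∑ i : Fin m,
          (if L.Owner (some x) i then (SetUnion.gap (L.Owner (some x)) i : ℝ) else 0) := by
          rw [Finset.mul_sum]
          refine Finset.sum_congr rfl fun i _ => ?_
          simp only [L.owner_some, SetList.gap]
          split_ifs
          · ring
          · simp
      _ = c := by
          rw [h2]
          field_simp
  rw [hmean, hcard, mul_comm _ (U.card : ℝ), mul_comm _ (U.card : ℝ), ← nsmul_eq_mul,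
    ← nsmul_eq_mul]
  constructor
  · refine Finset.card_nsmul_le_sum _ _ _ fun x hx => ?_
    rw [← hone x hx ((1 - αL) * (1 - βL))]
    refine Finset.sum_le_sum fun i _ => ?_
    split_ifs with hi
    · refine div_le_div_of_nonneg_right (mul_le_mul_of_nonneg_right ?_ (Nat.cast_nonneg _)) hm.le
      exact (size_mul_gen_bounds h hα hβ hβR hi).1
    · exact le_rfl
  · refine Finset.sum_le_card_nsmul _ _ _ fun x hx => ?_
    rw [← hone x hx ((1 + αR) * (1 + βR))]
    refine Finset.sum_le_sum fun i _ => ?_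
    split_ifs with hi
    · refine div_le_div_of_nonneg_right (mul_le_mul_of_nonneg_right ?_ (Nat.cast_nonneg _)) hm.le
      exact (size_mul_gen_bounds h hα hβ hβR hi).2
    · exact le_rfl

end Mean

/-! ## The program -/

namespace Program

/-- The address `0`. -/
abbrev z : NExp := .const 0

/-- The expected number of samples from the set whose number is in natural-number cell `1[0]`. -/
def expectedDraws : RExp := .mul (.get 2 z) (.div (.get 1 (.get 1 z)) (.get 0 (.const 2)))

/-- Requests a random element of the set in cell `1[0]` with the prescribed probability. -/
def drawBody : Prog :=
  -- With `d` expected draws, pass `k` draws with probability `min (d - k) 1`. The `⌈d⌉` passes of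
  -- `drawFrom` thus draw exactly `d` samples on average, without rounding.
  .seq (.coin 3 z (.sub expectedDraws (.ofNat (.get 2 z))))
    (.ite (.natLe (.const 1) (.get 3 z))
      (.seq (.setNat 5 (.get 4 z) (.get 1 z))
        (.seq (.askElem 0 (.get 4 z) (.get 1 z))
          (.setNat 4 z (.add (.get 4 z) (.const 1)))))
      .skip)

/-- Requests the samples from one set. -/
def drawFrom : Prog := .loop 2 expectedDraws drawBody

/-- Requests the samples from all sets. -/
def drawAll : Prog := .loop 1 (.ofNat (.get 0 z)) drawFrom

/-- Chooses random positions in the list of samples. -/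
def resample : Prog :=
  -- The last quotient is `1` for a nonempty list and `0 / 0 = 0` for an empty one, where no
  -- position can be chosen. Cell `13[0]` records the number of passes, since real numbers cannot be
  -- rounded.
  .loop 1
    (.mul (.div (.get 2 z) (.get 4 z)) (.div (.ofNat (.get 4 z)) (.ofNat (.get 4 z))))
    (.seq (.rand 6 (.get 1 z) (.get 4 z)) (.setNat 13 z (.add (.get 1 z) (.const 1))))

/-- Asks whether the current sample is in the sets that follow its own set. -/
def scan : Prog :=
  .loop 2 (.get 4 z)
    (.seq
      (.ite (.natLe (.get 0 z) (.add (.get 8 z) (.const 1)))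
        (.setNat 8 z (.const 0))
        (.setNat 8 z (.add (.get 8 z) (.const 1))))
      (.seq (.askMem 10 (.get 9 z) 1 (.get 1 z) (.get 8 z))
        (.setNat 9 z (.add (.get 9 z) (.const 1)))))

/-- Copies the chosen samples and asks for their memberships. -/
def scanAll : Prog :=
  .loop 1 (.ofNat (.get 13 z))
    (.seq (.setNat 7 (.get 1 z) (.get 5 (.get 6 (.get 1 z))))
      (.seq (.copyElem 1 (.get 1 z) 0 (.get 6 (.get 1 z)))
        (.seq (.setNat 8 z (.get 7 (.get 1 z))) scan)))

/-- Reads the answers for the current sample. -/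
def tally : Prog :=
  .loop 2 (.get 4 z)
    -- The flag is counted before it is updated, so the count ends at the minimum of the gap and the
    -- number of queries. Truncated subtraction keeps the flag at `0` after the first positive
    -- answer.
    (.seq (.setNat 12 z (.add (.get 12 z) (.get 11 z)))
      (.seq (.setNat 11 z (.sub (.get 11 z) (.get 10 (.get 9 z))))
        (.setNat 9 z (.add (.get 9 z) (.const 1)))))

/-- Accounts for the samples whose gap is known by now and lists the others. -/
def tallyAll : Prog :=
  .loop 1 (.ofNat (.get 13 z))
    (.seq (.setNat 11 z (.const 1))
      (.seq (.setNat 12 z (.const 0))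
        (.seq tally
          (.seq
            -- The factor one minus the flag lets a gap into the total only if it is known.
            (.setReal 6 z (.add (.get 6 z)
              (.mul (.mul (.get 5 z) (.ofNat (.get 12 z)))
                (.sub (.const 1) (.ofNat (.get 11 z))))))
            -- Every sample is written at the end of the list, but the length grows by the flag
            -- only, so an entry for a settled sample is discarded.
            (.seq (.setNat 5 (.get 4 z) (.get 7 (.get 1 z)))
              (.seq (.copyElem 0 (.get 4 z) 1 (.get 1 z))
                (.setNat 4 z (.add (.get 4 z) (.get 11 z)))))))))

/-- The deterministic part of a stage. -/
def sift : Prog :=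
  .seq (.setReal 4 z (.mul (.get 4 z) (.get 3 z)))
    (.seq (.setNat 9 z (.const 0))
      (.seq scanAll
        (.seq .round
          -- The `n` chosen samples represent the former list of `S`, hence the factor `S / n` in
          -- the weight.
          (.seq (.setReal 5 z
              (.mul (.get 5 z) (.div (.ofNat (.get 4 z)) (.ofNat (.get 13 z)))))
            (.seq (.setNat 4 z (.const 0))
              (.seq (.setNat 9 z (.const 0)) tallyAll))))))

/-- One stage. -/
def stage : Prog := .seq (.setNat 13 z (.const 0)) (.seq resample sift)

/-- The computation of the parameters. -/
def setup (K : ℕ) : Prog :=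
  -- The constant is chosen for a relative error `η = ε / (2(K+2))` per random step: `η² (R/m) / 4 =
  -- log (2(K+2)/γ)`, so each of the `K+2` steps fails with probability at most `γ/(K+2)`.
  .seq (.setReal 2 z (.mul (.mul (.ofNat (.get 0 z))
      (.div (.const (16 * ((K : ℚ) + 2) ^ 2)) (.mul (.get 0 z) (.get 0 z))))
      (.log (.div (.const (2 * ((K : ℚ) + 2))) (.get 0 (.const 1))))))
    (.seq (.setReal 3 z (.exp (.div (.log (.ofNat (.get 0 z))) (.const (K : ℚ)))))
      (.seq (.setReal 4 z (.const 1))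
        (.setReal 5 z (.div (.get 0 (.const 2)) (.mul (.get 2 z) (.ofNat (.get 0 z)))))))

/-- The first samples are drawn, and `k` stages follow. -/
def stages : ℕ → Prog
  | 0 => .seq drawAll .round
  | k + 1 => .seq (stages k) stage

/-- The algorithm with `K + 1` stages. -/
def main (K : ℕ) : Prog := .seq (setup K) (.seq (stages (K + 1)) (.setReal 0 z (.get 6 z)))

end Program

/-! ## Symbolic execution -/

section Execution

variable {E : Type*} {m : ℕ}

@[simp] lemma write_apply {β : Type*} (μ : ℕ → ℕ → β) (a i : ℕ) (v : β) (b j : ℕ) :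
    write μ a i v b j = if b = a ∧ j = i then v else μ b j := by
  unfold write
  by_cases hb : b = a
  · subst hb
    by_cases hj : j = i
    · subst hj
      simp
    · simp [hj]
  · simp [hb]

attribute [simp] NExp.eval NExp.cost RExp.eval RExp.cost Test.Holds Test.cost State.tick
  State.putNat State.putReal State.putElem State.issue

variable {L : SetList E m} {s : State E} {Q : State E → Prop}

lemma sure_seq {c d : Prog} :
    Sure ((Prog.seq c d).run L s) Q ↔ Sure (c.run L s) fun a => Sure (d.run L a) Q := by
  rw [Prog.run, sure_bind]

lemma sure_loop {x : ℕ} {r : RExp} {c : Prog} {n : ℕ} (I : ℕ → State E → Prop)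
    (hn : ⌈r.eval s⌉₊ = n) (h0 : I 0 (s.tick (r.cost + 1)))
    (hstep : ∀ k < n, ∀ a, I k a → Sure (c.run L ((a.putNat x 0 k).tick 1)) (I (k + 1))) :
    Sure ((Prog.loop x r c).run L s) (I n) := by
  rw [Prog.run, hn]
  exact sure_iter I n _ h0 hstep

open Classical in
/-- The value of an answer to a membership query. -/
def SetList.reply (L : SetList E m) (x : Option E) (i : Fin m) : ℕ := if L.Owner x i then 1 else 0

open Classical in
-- All requests for a cell `b` must have the same answer `f b`, so the order of arrival is
-- irrelevant. The alternative "already correct or still to be answered" carries the induction.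
lemma sure_answerAll_mem (f : ℕ → ℕ) (qs : List (Request E)) (s : State E)
    (h : ∀ q ∈ qs, ∃ (b : ℕ) (x : Option E) (i : Fin m), q = .mem 10 b x i ∧ L.reply x i = f b) :
    Sure (answerAll L qs s) fun s' =>
      (∀ a i, a ≠ 10 → s'.nat a i = s.nat a i) ∧ s'.real = s.real ∧ s'.elem = s.elem ∧
        s'.pending = s.pending ∧ s'.time = s.time ∧ s'.rounds = s.rounds ∧
        ∀ b, (s.nat 10 b = f b ∨ ∃ x k, .mem 10 b x k ∈ qs) → s'.nat 10 b = f b := by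
  induction qs generalizing s with
  | nil =>
    rw [answerAll, sure_pure]
    simp
  | cons q qs ih =>
    obtain ⟨b, x, i, rfl, hf⟩ := h q (List.mem_cons_self ..)
    rw [answerAll, sure_bind, answer, dif_pos i.2, sure_pure]
    have hf' : (if ∃ y ∈ L.set ⟨i, i.2⟩, x = some y then 1 else 0) = f b := by
      rw [← hf]
      exact if_congr Iff.rfl rfl rfl
    rw [hf']
    refine (ih (s.putNat 10 b (f b)) fun q hq => h q (List.mem_cons_of_mem _ hq)).mono ?_
    rintro s' ⟨h1, h2, h3, h4, h5, h6, h7⟩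
    refine ⟨fun a j ha => ?_, h2, h3, h4, h5, h6, fun c hc => ?_⟩
    · rw [h1 a j ha]
      simp [ha]
    · apply h7
      rcases hc with hc | ⟨y, k, hc⟩
      · left
        by_cases hcb : c = b
        · simp [hcb]
        · simp [hcb, hc]
      · rcases List.mem_cons.1 hc with hc | hc
        · left
          have hcb : c = b := by
            injection hc
          simp [hcb]
        · exact .inr ⟨y, k, hc⟩

end Execution

/-! ## The deterministic part of a stage -/

section Sift

variable {E : Type*} {m : ℕ} [NeZero m] (L : SetList E m)

/-- The membership queries for one sample. -/
def scanRequests (p : ℕ) (x : Option E) (i : Fin m) (τ : ℕ) : List (Request E) :=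
  (List.range τ).map fun e => .mem 10 (p + e) x (Fin.ofNat m (i + (e + 1)) : Fin m)

lemma sure_scan {s : State E} (i : Fin m) (τ : ℕ) (hm : s.nat 0 0 = m) (hi : s.nat 8 0 = i)
    (hτ : ⌈s.real 4 0⌉₊ = τ) :
    Sure (Program.scan.run L s) fun s' =>
      (∀ a j, a ≠ 2 → a ≠ 8 → a ≠ 9 → s'.nat a j = s.nat a j) ∧
        s'.real = s.real ∧ s'.elem = s.elem ∧ s'.rounds = s.rounds ∧
        s'.nat 9 0 = s.nat 9 0 + τ ∧
        s'.pending = s.pending ++ scanRequests (s.nat 9 0) (s.elem 1 (s.nat 1 0)) i τ ∧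
        s'.time ≤ s.time + 3 + 30 * τ := by
  refine (sure_loop (fun d s' =>
      (∀ a j, a ≠ 2 → a ≠ 8 → a ≠ 9 → s'.nat a j = s.nat a j) ∧
        s'.real = s.real ∧ s'.elem = s.elem ∧ s'.rounds = s.rounds ∧
        s'.nat 9 0 = s.nat 9 0 + d ∧
        s'.pending = s.pending ++ scanRequests (s.nat 9 0) (s.elem 1 (s.nat 1 0)) i d ∧
        s'.time ≤ s.time + 3 + 30 * d ∧ s'.nat 8 0 = (i + d) % m) (n := τ) ?_ ?_ ?_).mono ?_
  · simpa using hτ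
  · simp [scanRequests, hi, Nat.mod_eq_of_lt i.2]
  · rintro d - a ⟨h1, h2, h3, h4, h5, h6, h7, h8⟩
    have e1 : a.nat 0 0 = m := by rw [h1 0 0 (by decide) (by decide) (by decide), hm]
    have hlt : (i + d) % m < m := Nat.mod_lt _ (NeZero.pos m)
    have hsucc : (i + (d + 1)) % m = ((i + d) % m + 1) % m := by
      rw [Nat.mod_add_mod, add_assoc]
    have hreq : ∀ (p : ℕ) (x : Option E), scanRequests p x i (d + 1) =
        scanRequests p x i d ++ [.mem 10 (p + d) x ((i + (d + 1)) % m)] := by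
      intro p x
      simp [scanRequests, List.range_succ]
    by_cases hw : m ≤ (i + d) % m + 1
    · have : (i + (d + 1)) % m = 0 := by
        rw [hsucc, show (i + d) % m + 1 = m by omega, Nat.mod_self]
      simp only [Prog.run, sure_bind, sure_pure]
      rw [if_pos (by simp [e1, h8, hw])]
      simp only [sure_pure]
      simp +contextual [h1, h2, h3, h4, h5, h6, hreq, this]
      omega
    · have : (i + (d + 1)) % m = (i + d) % m + 1 := by
        rw [hsucc, Nat.mod_eq_of_lt (by omega)]
      simp only [Prog.run, sure_bind, sure_pure]
      rw [if_neg (by simp [e1, h8]; omega)]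
      simp only [sure_pure]
      simp +contextual [h1, h2, h3, h4, h5, h6, h8, hreq, this]
      omega
  · rintro s' ⟨h1, h2, h3, h4, h5, h6, h7, -⟩
    exact ⟨h1, h2, h3, h4, h5, h6, h7⟩

/-- The membership queries for `n` samples. -/
def allRequests (X : ℕ → Option E) (I : ℕ → Fin m) (τ n : ℕ) : List (Request E) :=
  (List.range n).flatMap fun j => scanRequests (j * τ) (X j) (I j) τ

lemma sure_scanAll {s : State E} (I : ℕ → Fin m) (τ n : ℕ) (hm : s.nat 0 0 = m)
    (hn : s.nat 13 0 = n) (hp : s.nat 9 0 = 0) (hq : s.pending = [])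
    (hτ : ⌈s.real 4 0⌉₊ = τ) (hI : ∀ j < n, s.nat 5 (s.nat 6 j) = I j) :
    Sure (Program.scanAll.run L s) fun s' =>
      (∀ a j, a ≠ 1 → a ≠ 2 → a ≠ 7 → a ≠ 8 → a ≠ 9 → s'.nat a j = s.nat a j) ∧
        s'.real = s.real ∧ s'.rounds = s.rounds ∧
        s'.pending = allRequests (fun j => s.elem 0 (s.nat 6 j)) I τ n ∧
        s'.time ≤ s.time + 4 + n * (30 * τ + 40) ∧
        ∀ j < n, s'.nat 7 j = I j ∧ s'.elem 1 j = s.elem 0 (s.nat 6 j) := by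
  refine (sure_loop (fun J s' =>
      (∀ a j, a ≠ 1 → a ≠ 2 → a ≠ 7 → a ≠ 8 → a ≠ 9 → s'.nat a j = s.nat a j) ∧
        s'.real = s.real ∧ s'.rounds = s.rounds ∧
        s'.pending = allRequests (fun j => s.elem 0 (s.nat 6 j)) I τ J ∧
        s'.time ≤ s.time + 4 + J * (30 * τ + 40) ∧
        (∀ j < J, s'.nat 7 j = I j ∧ s'.elem 1 j = s.elem 0 (s.nat 6 j)) ∧
        s'.nat 9 0 = J * τ ∧ s'.elem 0 = s.elem 0) (n := n) ?_ ?_ ?_).mono ?_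
  · simp [hn]
  · simp [allRequests, hq, hp]
  · rintro J hJ a ⟨h1, h2, h3, h4, h5, h6, h7, h8⟩
    have e0 : a.nat 0 0 = m := by rw [h1 0 0 (by decide) (by decide) (by decide) (by decide)
      (by decide), hm]
    have e5 : ∀ j, a.nat 5 j = s.nat 5 j := fun j => h1 5 j (by decide) (by decide) (by decide)
      (by decide) (by decide)
    have e6 : ∀ j, a.nat 6 j = s.nat 6 j := fun j => h1 6 j (by decide) (by decide) (by decide)
      (by decide) (by decide)
    have hIJ := hI J hJ
    simp only [sure_seq]
    simp only [Prog.run, sure_pure]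
    refine (sure_scan L (I J) τ ?_ ?_ ?_).mono ?_
    · simp [e0]
    · simp [e5, e6, hIJ]
    · simp [h2, hτ]
    · rintro b ⟨g1, g2, g3, g4, g5, g6, g7⟩
      simp [h2, h3, h4, h7, h8, e6] at g2 g3 g4 g5 g6 g7
      refine ⟨?_, g2, g4, ?_, ?_, ?_, ?_, ?_⟩
      · intro c j c1 c2 c7 c8 c9
        rw [g1 c j c2 c8 c9]
        simp [c1, c7, c8, h1 c j c1 c2 c7 c8 c9]
      · rw [g6]
        simp [allRequests, List.range_succ]
      · refine g7.trans ?_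
        linarith
      · intro j hj
        rw [g1 7 j (by decide) (by decide) (by decide), g3]
        rcases Nat.lt_succ_iff_lt_or_eq.1 hj with hj | rfl
        · simp [hj.ne, h6 j hj]
        · simp [e5, e6, hIJ]
      · rw [g5]
        ring
      · rw [g3]
        funext q
        simp [h8]
  · rintro s' ⟨h1, h2, h3, h4, h5, h6, -⟩
    exact ⟨h1, h2, h3, h4, h5, h6⟩

lemma length_allRequests (X : ℕ → Option E) (I : ℕ → Fin m) (τ n : ℕ) :
    (allRequests X I τ n).length = n * τ := by
  simp [allRequests, scanRequests, List.length_flatMap]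

lemma sure_answerAll_allRequests (X : ℕ → Option E) (I : ℕ → Fin m) (τ n : ℕ) (s : State E) :
    Sure (answerAll L (allRequests X I τ n) s) fun s' =>
      (∀ a i, a ≠ 10 → s'.nat a i = s.nat a i) ∧ s'.real = s.real ∧ s'.elem = s.elem ∧
        s'.pending = s.pending ∧ s'.time = s.time ∧ s'.rounds = s.rounds ∧
        ∀ j < n, ∀ e < τ,
          s'.nat 10 (j * τ + e) = L.reply (X j) (Fin.ofNat m (I j + (e + 1))) := by
  have hmem : ∀ q, q ∈ allRequests X I τ n ↔ ∃ j < n, ∃ e < τ,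
      q = .mem 10 (j * τ + e) (X j) (Fin.ofNat m (I j + (e + 1)) : Fin m) := by
    intro q
    simp [allRequests, scanRequests, eq_comm]
  -- Division by `τ` recovers the sample `j` and the offset `e` from the address of the answer.
  have hdiv : ∀ j e : ℕ, e < τ → (j * τ + e) / τ = j ∧ (j * τ + e) % τ = e := by
    intro j e he
    rw [mul_comm, Nat.mul_add_div (by omega), Nat.div_eq_of_lt he, Nat.mul_add_mod,
      Nat.mod_eq_of_lt he]
    simp
  refine (sure_answerAll_mem (fun b => L.reply (X (b / τ)) (Fin.ofNat m (I (b / τ) + (b % τ + 1))))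
    _ s ?_).mono ?_
  · intro q hq
    obtain ⟨j, hj, e, he, rfl⟩ := (hmem q).1 hq
    refine ⟨_, _, _, rfl, ?_⟩
    simp only [hdiv j e he]
  · rintro s' ⟨h1, h2, h3, h4, h5, h6, h7⟩
    refine ⟨h1, h2, h3, h4, h5, h6, fun j hj e he => ?_⟩
    rw [h7 _ (.inr ⟨_, _, (hmem _).2 ⟨j, hj, e, he, rfl⟩⟩)]
    simp only [hdiv j e he]

lemma sure_tally {s : State E} (x : Option E) (i : Fin m) (τ : ℕ) (hx : L.Owner x i)
    (h11 : s.nat 11 0 = 1) (h12 : s.nat 12 0 = 0) (hτ : ⌈s.real 4 0⌉₊ = τ)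
    (h10 : ∀ e < τ, s.nat 10 (s.nat 9 0 + e) = L.reply x (Fin.ofNat m (i + (e + 1)))) :
    Sure (Program.tally.run L s) fun s' =>
      (∀ a j, a ≠ 2 → a ≠ 9 → a ≠ 11 → a ≠ 12 → s'.nat a j = s.nat a j) ∧
        s'.real = s.real ∧ s'.elem = s.elem ∧ s'.pending = s.pending ∧ s'.rounds = s.rounds ∧
        s'.nat 9 0 = s.nat 9 0 + τ ∧ s'.nat 12 0 = min τ (L.gap x i) ∧
        s'.nat 11 0 = (if τ < L.gap x i then 1 else 0) ∧
        s'.time ≤ s.time + 3 + 30 * τ := by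
  refine (sure_loop (fun d s' =>
      (∀ a j, a ≠ 2 → a ≠ 9 → a ≠ 11 → a ≠ 12 → s'.nat a j = s.nat a j) ∧
        s'.real = s.real ∧ s'.elem = s.elem ∧ s'.pending = s.pending ∧ s'.rounds = s.rounds ∧
        s'.nat 9 0 = s.nat 9 0 + d ∧ s'.nat 12 0 = min d (L.gap x i) ∧
        s'.nat 11 0 = (if d < L.gap x i then 1 else 0) ∧
        s'.time ≤ s.time + 3 + 30 * d) (n := τ) ?_ ?_ ?_)
  · simpa using hτ
  · have := (L.gap_bounds hx).1
    simp [h11, h12]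
    omega
  · rintro d hd a ⟨h1, h2, h3, h4, h5, h6, h7, h8, h9⟩
    have e10 := h10 d hd
    have hs : d + 1 < L.gap x i ↔ d < L.gap x i ∧ ¬ L.Owner x (Fin.ofNat m (i + (d + 1))) :=
      succ_lt_gap_iff ⟨i, hx⟩ i d
    simp only [Prog.run, sure_bind, sure_pure]
    simp +contextual [h1, h2, h3, h4, h5, h6, h7, h8, e10, -Fin.ofNat_eq_cast]
    simp only [SetList.reply]
    refine ⟨by omega, ?_, ?_, by omega⟩
    · by_cases hg : d < L.gap x i
      · rw [if_pos hg, min_eq_left hg.le, min_eq_left hg]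
      · rw [if_neg hg, min_eq_right (by omega), min_eq_right (by omega), add_zero]
    · by_cases ho : L.Owner x (Fin.ofNat m (i + (d + 1))) <;>
        by_cases hd : d < L.gap x i <;> simp [ho, hd, hs, -Fin.ofNat_eq_cast]

end Sift

/-! ### Settled and surviving samples, and the conservation of the potential -/

section Tally

variable {E : Type*} {m : ℕ} [NeZero m] (L : SetList E m)

/-- The gap of the sample number `q` in the list of samples. -/
def State.gapAt (s : State E) (q : ℕ) : ℕ := L.gap (s.elem 0 q) (Fin.ofNat m (s.nat 5 q))

/-- The samples in the list are in their sets and their gaps are at least `t`. -/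
def State.Valid (s : State E) (t : ℝ) : Prop :=
  ∀ q < s.nat 4 0, s.nat 5 q < m ∧ L.Owner (s.elem 0 q) (Fin.ofNat m (s.nat 5 q)) ∧
    t ≤ s.gapAt L q

/-- The estimate if the gaps of the samples in the list were known. -/
def State.potential (s : State E) : ℝ :=
  s.real 6 0 + s.real 5 0 * ∑ q ∈ Finset.range (s.nat 4 0), (s.gapAt L q : ℝ)

lemma ofNat_val (i : Fin m) : Fin.ofNat m i = i := by
  ext
  simp

/-- A sample raises the potential by weight times gap in either case: through the total if the gap
was found, through the list if it was not. Survivors have gap above `τ`, hence above the depth. -/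
lemma sure_tallyAll {s : State E} (I : ℕ → Fin m) (τ n : ℕ) (hn : s.nat 13 0 = n)
    (h9 : s.nat 9 0 = 0) (h4 : s.nat 4 0 = 0) (hw : 0 ≤ s.real 5 0)
    (hτ : ⌈s.real 4 0⌉₊ = τ) (hI : ∀ j < n, s.nat 7 j = I j)
    (hX : ∀ j < n, L.Owner (s.elem 1 j) (I j))
    (h10 : ∀ j < n, ∀ e < τ,
      s.nat 10 (j * τ + e) = L.reply (s.elem 1 j) (Fin.ofNat m (I j + (e + 1)))) :
    Sure (Program.tallyAll.run L s) fun s' =>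
      s'.nat 0 0 = s.nat 0 0 ∧ (∀ a j, a ≠ 6 → s'.real a j = s.real a j) ∧
        s'.pending = s.pending ∧ s'.rounds = s.rounds ∧ s.real 6 0 ≤ s'.real 6 0 ∧
        s'.Valid L (s.real 4 0) ∧
        s'.potential L = s.real 6 0 +
          s.real 5 0 * ∑ j ∈ Finset.range n, (L.gap (s.elem 1 j) (I j) : ℝ) ∧
        s'.time ≤ s.time + 4 + n * (30 * τ + 60) := by
  refine (sure_loop (fun J s' =>
      (∀ a j, a ≠ 1 → a ≠ 2 → a ≠ 4 → a ≠ 5 → a ≠ 9 → a ≠ 11 → a ≠ 12 →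
        s'.nat a j = s.nat a j) ∧ (∀ a j, a ≠ 6 → s'.real a j = s.real a j) ∧
        s'.pending = s.pending ∧ s'.rounds = s.rounds ∧
        s'.time ≤ s.time + 4 + J * (30 * τ + 60) ∧ s'.nat 9 0 = J * τ ∧
        s'.elem 1 = s.elem 1 ∧ s.real 6 0 ≤ s'.real 6 0 ∧ s'.Valid L (s.real 4 0) ∧
        s'.potential L = s.real 6 0 +
          s.real 5 0 * ∑ j ∈ Finset.range J, (L.gap (s.elem 1 j) (I j) : ℝ)) (n := n) ?_ ?_ ?_).mono ?_
  · simp [hn]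
  · simp [State.Valid, State.potential, h4, h9]
  · rintro J hJ a ⟨g1, g2, g3, g4, g8, g9, g10, g5, g6, g7⟩
    have e7 : a.nat 7 J = I J := by
      rw [g1 7 J (by decide) (by decide) (by decide) (by decide) (by decide) (by decide)
        (by decide), hI J hJ]
    have e10 : ∀ b, a.nat 10 b = s.nat 10 b := fun b => g1 10 b (by decide) (by decide)
      (by decide) (by decide) (by decide) (by decide) (by decide)
    have eg := (L.gap_bounds (hX J hJ)).1
    simp only [sure_seq]
    simp only [Prog.run, sure_pure]
    refine (sure_tally L (s.elem 1 J) (I J) τ (hX J hJ) ?_ ?_ ?_ ?_).mono ?_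
    · simp
    · simp
    · simp [g2, hτ]
    · simpa [g9, e10, -Fin.ofNat_eq_cast] using h10 J hJ
    · rintro b ⟨f1, f2, f3, f4, f5, f6, f7, f8, f9⟩
      have k4 : b.nat 4 0 = a.nat 4 0 := by
        rw [f1 4 0 (by decide) (by decide) (by decide) (by decide)]; simp
      have k5 : ∀ q, b.nat 5 q = a.nat 5 q := fun q => by
        rw [f1 5 q (by decide) (by decide) (by decide) (by decide)]; simp
      have k7 : b.nat 7 J = I J := by
        rw [f1 7 J (by decide) (by decide) (by decide) (by decide)]; simp [e7]
      have k1 : b.nat 1 0 = J := by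
        rw [f1 1 0 (by decide) (by decide) (by decide) (by decide)]; simp
      simp at f2 f3 f4 f5 f6 f9
      have kreal : b.real 5 0 = s.real 5 0 := by rw [f2, g2 5 0 (by decide)]
      have kel : b.elem 1 J = s.elem 1 J := by rw [f3, g10]
      -- `t` stands for the state after the last assignments of the pass; only these five facts
      -- about it matter.
      have hmain : ∀ t : State E, t.nat 4 0 = b.nat 4 0 + b.nat 11 0 →
          (∀ q, t.nat 5 q = if q = b.nat 4 0 then b.nat 7 J else b.nat 5 q) →
          (∀ q, t.elem 0 q = if q = b.nat 4 0 then b.elem 1 J else b.elem 0 q) →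
          t.real 6 0 = b.real 6 0 + b.real 5 0 * b.nat 12 0 * (1 - b.nat 11 0) →
          t.real 5 0 = b.real 5 0 →
          s.real 6 0 ≤ t.real 6 0 ∧ t.Valid L (s.real 4 0) ∧
          t.potential L = s.real 6 0 +
            s.real 5 0 * ∑ j ∈ Finset.range (J + 1), (L.gap (s.elem 1 j) (I j) : ℝ) := by
        intro t t4 t5 te t6 tw
        have hold : ∀ q < a.nat 4 0, t.nat 5 q = a.nat 5 q ∧ t.elem 0 q = a.elem 0 q := by
          intro q hq
          rw [t5, te, k4, if_neg hq.ne, if_neg hq.ne, k5, f3]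
          simp
        have hgap : ∀ q < a.nat 4 0, t.gapAt L q = a.gapAt L q := by
          intro q hq
          rw [State.gapAt, State.gapAt, (hold q hq).1, (hold q hq).2]
        have hsum : ∑ q ∈ Finset.range (a.nat 4 0), (t.gapAt L q : ℝ) =
            ∑ q ∈ Finset.range (a.nat 4 0), (a.gapAt L q : ℝ) :=
          Finset.sum_congr rfl fun q hq => by rw [hgap q (Finset.mem_range.1 hq)]
        have a6 : b.real 6 0 = a.real 6 0 := by rw [f2]
        have hpot := g7
        rw [State.potential, g2 5 0 (by decide)] at hpot
        rw [State.potential, tw, kreal, Finset.sum_range_succ, t6, a6, kreal, t4, k4]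
        by_cases hg : τ < L.gap (s.elem 1 J) (I J)
        · rw [if_pos hg] at f8
          have tS := t5 (a.nat 4 0)
          have teS := te (a.nat 4 0)
          rw [if_pos k4.symm, k7] at tS
          rw [if_pos k4.symm, kel] at teS
          have hS : t.gapAt L (a.nat 4 0) = L.gap (s.elem 1 J) (I J) := by
            rw [State.gapAt, tS, teS, ofNat_val]
          rw [f8, Finset.sum_range_succ, hsum, hS]
          refine ⟨?_, ?_, ?_⟩
          · simpa using g5
          · intro q hq
            rw [t4, k4, f8] at hq
            rcases Nat.lt_succ_iff_lt_or_eq.1 hq with hq | rfl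
            · rw [(hold q hq).1, (hold q hq).2, hgap q hq]
              exact g6 q hq
            · rw [tS, teS, hS, ofNat_val]
              refine ⟨(I J).2, hX J hJ, ?_⟩
              refine (Nat.le_ceil _).trans ?_
              rw [hτ]
              exact_mod_cast hg.le
          · push_cast
            linarith
        · rw [if_neg hg] at f8
          rw [min_eq_right (not_lt.1 hg)] at f7
          rw [f8, f7, add_zero, hsum]
          refine ⟨?_, ?_, ?_⟩
          · have : 0 ≤ s.real 5 0 * (L.gap (s.elem 1 J) (I J) : ℝ) := by positivity
            push_cast
            linarith
          · intro q hq
            rw [t4, k4, f8, add_zero] at hq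
            rw [(hold q hq).1, (hold q hq).2, hgap q hq]
            exact g6 q hq
          · push_cast
            linarith
      refine ⟨?_, ?_, ?_, ?_, ?_, ?_, ?_, hmain _ ?_ (fun q => ?_) (fun q => ?_) ?_ ?_⟩
      · intro c j c1 c2 c4 c5 c9 c11 c12
        simp [c4, c5, f1 c j c2 c9 c11 c12, c1, c11, c12, g1 c j c1 c2 c4 c5 c9 c11 c12]
      · intro c j hc
        simp [hc, f2, g2 c j hc]
      · simp [f4, g3]
      · simp [f5, g4]
      · simp
        linarith
      · simp [f6, g9]
        ring
      · funext q
        simp [f3, g10]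
      all_goals simp [k1]
  · rintro s' ⟨h1, h2, h3, h4, h8, -, -, h5, h6, h7⟩
    exact ⟨h1 0 0 (by decide) (by decide) (by decide) (by decide) (by decide) (by decide)
      (by decide), h2, h3, h4, h5, h6, h7, h8⟩

lemma sure_sift {s : State E} (t : ℝ) (τ n : ℕ) (hm : s.nat 0 0 = m) (hn : s.nat 13 0 = n)
    (hp : s.pending = []) (hw : 0 ≤ s.real 5 0) (hτ : ⌈s.real 4 0 * s.real 3 0⌉₊ = τ)
    (hV : s.Valid L t) (hr : ∀ j < n, s.nat 6 j < s.nat 4 0) :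
    Sure (Program.sift.run L s) fun s' =>
      s'.nat 0 0 = m ∧ s'.real 2 0 = s.real 2 0 ∧ s'.real 3 0 = s.real 3 0 ∧
        s'.real 4 0 = s.real 4 0 * s.real 3 0 ∧ 0 ≤ s'.real 5 0 ∧
        s.real 6 0 ≤ s'.real 6 0 ∧ s'.pending = [] ∧ s'.rounds = s.rounds + 1 ∧
        s'.Valid L (s.real 4 0 * s.real 3 0) ∧
        s'.potential L = s.real 6 0 + s.real 5 0 * ((s.nat 4 0 : ℝ) / n) *
          ∑ j ∈ Finset.range n, (s.gapAt L (s.nat 6 j) : ℝ) ∧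
        s'.time ≤ s.time + 100 + n * (100 * τ + 150) := by
  set I : ℕ → Fin m := fun j => Fin.ofNat m (s.nat 5 (s.nat 6 j)) with hIdef
  have hI : ∀ j < n, s.nat 5 (s.nat 6 j) = I j := fun j hj => by
    simp [hIdef, Nat.mod_eq_of_lt (hV _ (hr j hj)).1]
  simp only [Program.sift, sure_seq]
  simp only [Prog.run, sure_pure]
  refine (sure_scanAll L I τ n ?_ ?_ ?_ ?_ ?_ ?_).mono ?_
  · simp [hm]
  · simp [hn]
  · simp
  · simp [hp]
  · simp [hτ]
  · simpa using hI
  · rintro a ⟨h1, h2, h3, h4, h5, h6⟩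
    simp at h2 h3 h4 h5 h6
    rw [h4]
    refine (sure_answerAll_allRequests L _ I τ n _).mono ?_
    rintro b ⟨g1, g2, g3, g4, g5, g6, g7⟩
    simp only [length_allRequests] at g1 g2 g3 g4 g5 g6 g7
    have b13 : b.nat 13 0 = n := by
      rw [g1 13 0 (by decide), h1 13 0 (by decide) (by decide) (by decide) (by decide) (by decide)]
      simp [hn]
    have b4 : b.nat 4 0 = s.nat 4 0 := by
      rw [g1 4 0 (by decide), h1 4 0 (by decide) (by decide) (by decide) (by decide) (by decide)]
      simp
    have b0 : b.nat 0 0 = m := by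
      rw [g1 0 0 (by decide), h1 0 0 (by decide) (by decide) (by decide) (by decide) (by decide)]
      simp [hm]
    have b7 : ∀ j < n, b.nat 7 j = I j := fun j hj => by
      rw [g1 7 j (by decide), (h6 j hj).1]
    have bel : ∀ j < n, b.elem 1 j = s.elem 0 (s.nat 6 j) := fun j hj => by
      rw [g3]
      exact (h6 j hj).2
    have hw' : 0 ≤ s.real 5 0 * ((s.nat 4 0 : ℝ) / n) := by positivity
    have b5 : b.real 5 0 = s.real 5 0 := by
      rw [g2]
      simp [h2]
    refine (sure_tallyAll L I τ n ?_ ?_ ?_ ?_ ?_ ?_ ?_ ?_).mono ?_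
    · simp [b13]
    · simp
    · simp
    · simpa [b13, b4, b5] using hw'
    · simp [g2, h2, hτ]
    · simpa using b7
    · intro j hj
      simpa [bel j hj, hIdef, -Fin.ofNat_eq_cast] using (hV _ (hr j hj)).2.1
    · intro j hj e he
      simpa [bel j hj, -Fin.ofNat_eq_cast] using g7 j hj e he
    · rintro c ⟨f1, f2, f3, f4, f5, f6, f7, f8⟩
      have hc5 : c.real 5 0 = s.real 5 0 * ((s.nat 4 0 : ℝ) / n) := by
        rw [f2 5 0 (by decide)]
        simp [b13, b4, b5]
      refine ⟨?_, ?_, ?_, ?_, ?_, ?_, ?_, ?_, ?_, ?_, ?_⟩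
      · rw [f1]
        simp [b0]
      · rw [f2 2 0 (by decide)]
        simp [g2, h2]
      · rw [f2 3 0 (by decide)]
        simp [g2, h2]
      · rw [f2 4 0 (by decide)]
        simp [g2, h2]
      · rw [hc5]
        exact hw'
      · simpa [g2, h2] using f5
      · rw [f3]
        simp [g4]
      · rw [f4]
        simp [g6, h3]
      · simpa [g2, h2] using f6
      · rw [f7]
        simp only [State.gapAt]
        simp [g2, h2, b13, b4, -Fin.ofNat_eq_cast]
        left
        refine Finset.sum_congr rfl fun j hj => ?_
        rw [bel j (Finset.mem_range.1 hj)]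
      · simp [g5] at f8
        have := Nat.zero_le (n * τ)
        linarith

end Tally

/-! ## Resampling -/

section Resample

variable {E : Type*} {m : ℕ} (L : SetList E m)

/-- What is known during the resampling after `k` passes. -/
def ResampleInv (s : State E) (k : ℕ) (a : State E) : Prop :=
  (∀ b j, b ≠ 1 → b ≠ 6 → b ≠ 13 → a.nat b j = s.nat b j) ∧ a.real = s.real ∧ a.elem = s.elem ∧
    a.pending = s.pending ∧ a.rounds = s.rounds ∧ a.nat 13 0 = k ∧
    (∀ j < k, a.nat 6 j < s.nat 4 0) ∧ a.time ≤ s.time + 20 + k * 20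

/-- Relies on `0 / 0 = 0`: whenever a position is drawn, there is a sample to choose. -/
lemma ceil_pos_imp {S n : ℕ} {x : ℝ} (hn : ⌈x * ((S : ℝ) / S)⌉₊ = n) (h : 0 < n) : 0 < S := by
  rcases Nat.eq_zero_or_pos S with rfl | hS
  · simp at hn
    omega
  · exact hS

/-- `14` is the charge for entering the loop: `13` for evaluating its bound and one more. -/
lemma resample_zero (s : State E) (h13 : s.nat 13 0 = 0) :
    ResampleInv s 0 (s.tick 14) := by
  simp [ResampleInv, h13]

lemma resample_step {s a : State E} {k : ℕ} (h : ResampleInv s k a) (hS : 0 < s.nat 4 0) :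
    Sure ((Prog.seq (.rand 6 (.get 1 Program.z) (.get 4 Program.z))
      (.setNat 13 Program.z (.add (.get 1 Program.z) (.const 1)))).run L ((a.putNat 1 0 k).tick 1))
      (ResampleInv s (k + 1)) := by
  obtain ⟨h1, h2, h3, h4, h5, h6, h7, h8⟩ := h
  have e4 : a.nat 4 0 = s.nat 4 0 := h1 4 0 (by decide) (by decide) (by decide)
  simp only [Prog.run, sure_bind, sure_map]
  simp only [NExp.eval, State.tick, State.putNat, write_apply]
  simp only [e4, show ((4 : ℕ) = 1) = False by simp, false_and, if_false]
  refine (sure_randDist hS).mono fun v hv => ?_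
  rw [sure_pure]
  refine ⟨?_, ?_, ?_, ?_, ?_, ?_, ?_, ?_⟩
  · intro b j b1 b6 b13
    simp [b1, b6, b13, h1 b j b1 b6 b13]
  · simp [h2]
  · simp [h3]
  · simp [h4]
  · simp [h5]
  · simp
  · intro j hj
    rcases Nat.lt_succ_iff_lt_or_eq.1 hj with hj | rfl
    · simp [hj.ne, h7 j hj]
    · simp [hv]
  · simp
    linarith

lemma sure_resample {s : State E} (n : ℕ) (h13 : s.nat 13 0 = 0)
    (hn : ⌈s.real 2 0 / s.real 4 0 * ((s.nat 4 0 : ℝ) / s.nat 4 0)⌉₊ = n) :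
    Sure (Program.resample.run L s) (ResampleInv s n) := by
  refine sure_loop (ResampleInv s) (n := n) (by simpa using hn) (resample_zero s h13) ?_
  intro k hk a ha
  exact resample_step L ha (ceil_pos_imp hn (by omega))

lemma pexp_resample {s : State E} (n : ℕ) (h13 : s.nat 13 0 = 0)
    (hn : ⌈s.real 2 0 / s.real 4 0 * ((s.nat 4 0 : ℝ) / s.nat 4 0)⌉₊ = n) (u : ℕ → ℝ)
    (hu0 : ∀ q < s.nat 4 0, 0 ≤ u q) (hu1 : ∀ q < s.nat 4 0, u q ≤ 1) (l : ℝ) :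
    pexp (Program.resample.run L s)
        (fun a => ENNReal.ofReal (Real.exp (l * ∑ j ∈ Finset.range n, u (a.nat 6 j)))) ≤
      ENNReal.ofReal (Real.exp ((Real.exp l - 1) *
        (n * ((s.nat 4 0 : ℝ)⁻¹ * ∑ q ∈ Finset.range (s.nat 4 0), u q)))) := by
  set S := s.nat 4 0 with hS
  set avg := (S : ℝ)⁻¹ * ∑ q ∈ Finset.range S, u q with havg
  have hr : ⌈RExp.eval s (.mul (.div (.get 2 Program.z) (.get 4 Program.z))
      (.div (.ofNat (.get 4 Program.z)) (.ofNat (.get 4 Program.z))))⌉₊ = n := by simpa using hn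
  rw [Program.resample, Prog.run, hr]
  have := pexp_iter (f := fun k s' => (Prog.seq (.rand 6 (.get 1 Program.z) (.get 4 Program.z))
      (.setNat 13 Program.z (.add (.get 1 Program.z) (.const 1)))).run L ((s'.putNat 1 0 k).tick 1))
    (ResampleInv s)
    -- The choices made enter exactly; each of the `n - k` outstanding ones is replaced by its bound
    -- `1 + (e^l - 1) avg ≤ exp ((e^l - 1) avg)`.
    (fun k a => ENNReal.ofReal (Real.exp (l * ∑ j ∈ Finset.range k, u (a.nat 6 j) +
      (n - k) * ((Real.exp l - 1) * avg)))) n _ (resample_zero s h13)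
    (fun k hk a ha => resample_step L ha (ceil_pos_imp hn (by omega))) ?_
  · refine (le_of_eq ?_).trans (this.trans (le_of_eq ?_))
    · simp only [sub_self, zero_mul, add_zero]
      rfl
    · simp
      ring_nf
  · rintro k hk a ⟨h1, -, -, -, -, -, -, -⟩
    have hSpos : 0 < S := ceil_pos_imp hn (by omega)
    have e4 : a.nat 4 0 = S := h1 4 0 (by decide) (by decide) (by decide)
    simp only [Prog.run, pexp_bind, pexp_map, pexp_pure]
    have hstep : ∀ c : ℝ, ∀ v : ℕ,
        ENNReal.ofReal (Real.exp (c + l * u v)) =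
          ENNReal.ofReal (Real.exp c) * ENNReal.ofReal (Real.exp (l * u v)) := by
      intro c v
      rw [Real.exp_add, ENNReal.ofReal_mul (Real.exp_nonneg _)]
    have hval : ∀ v : ℕ, ∑ j ∈ Finset.range (k + 1), u (write (write (write a.nat 1 0 k) 6 k v) 13 0
        (k + 1) 6 j) = ∑ j ∈ Finset.range k, u (a.nat 6 j) + u v := by
      intro v
      rw [Finset.sum_range_succ]
      congr 1
      · refine Finset.sum_congr rfl fun j hj => ?_
        simp [(Finset.mem_range.1 hj).ne]
      · simp
    simp [e4] at hval ⊢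
    simp only [hval]
    have hrw : ∀ v : ℕ, l * (∑ j ∈ Finset.range k, u (a.nat 6 j) + u v) +
        (n - (k + 1)) * ((Real.exp l - 1) * avg) =
        (l * ∑ j ∈ Finset.range k, u (a.nat 6 j) + (n - (k + 1)) * ((Real.exp l - 1) * avg)) +
          l * u v := fun v => by ring
    simp only [hrw, hstep]
    rw [pexp_const_mul]
    refine (mul_le_mul_right (pexp_exp_le (randDist S) (Finset.range S) ?_ u ?_ ?_ l) _).trans ?_
    · intro v hv
      rw [PMF.apply_eq_zero_iff]
      exact fun hv' => hv (Finset.mem_range.2 (sure_randDist hSpos v hv'))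
    · exact fun q hq => hu0 q (Finset.mem_range.1 hq)
    · exact fun q hq => hu1 q (Finset.mem_range.1 hq)
    · have : ∑ q ∈ Finset.range S, (randDist S q).toReal * u q = avg := by
        rw [havg, Finset.mul_sum]
        exact Finset.sum_congr rfl fun q hq => by
          rw [randDist_apply hSpos (Finset.mem_range.1 hq)]
      rw [this, ← ENNReal.ofReal_mul (Real.exp_nonneg _)]
      refine ENNReal.ofReal_le_ofReal ?_
      calc _ ≤ Real.exp (l * ∑ j ∈ Finset.range k, u (a.nat 6 j) +
            (n - (k + 1)) * ((Real.exp l - 1) * avg)) * Real.exp ((Real.exp l - 1) * avg) := by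
            gcongr
            linarith [Real.add_one_le_exp ((Real.exp l - 1) * avg)]
        _ = _ := by
            rw [← Real.exp_add]
            ring_nf

lemma fails_resample {s : State E} (n : ℕ) (h13 : s.nat 13 0 = 0)
    (hn : ⌈s.real 2 0 / s.real 4 0 * ((s.nat 4 0 : ℝ) / s.nat 4 0)⌉₊ = n) (u : ℕ → ℝ)
    (hu0 : ∀ q < s.nat 4 0, 0 ≤ u q) (hu1 : ∀ q < s.nat 4 0, u q ≤ 1) {η : ℝ} (hη0 : 0 < η)
    (hη1 : η ≤ 1) :
    Fails (Program.resample.run L s)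
      (fun a => |∑ j ∈ Finset.range n, u (a.nat 6 j) -
          n * ((s.nat 4 0 : ℝ)⁻¹ * ∑ q ∈ Finset.range (s.nat 4 0), u q)| ≤
        η * (n * ((s.nat 4 0 : ℝ)⁻¹ * ∑ q ∈ Finset.range (s.nat 4 0), u q)))
      (ENNReal.ofReal (2 * Real.exp (-(η ^ 2 *
        (n * ((s.nat 4 0 : ℝ)⁻¹ * ∑ q ∈ Finset.range (s.nat 4 0), u q)) / 4)))) := by
  refine fails_of_mgf _ _ _ η ?_ hη0 hη1 (pexp_resample L n h13 hn u hu0 hu1)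
  have := Finset.sum_nonneg fun q (hq : q ∈ Finset.range (s.nat 4 0)) =>
    hu0 q (Finset.mem_range.1 hq)
  positivity

end Resample

/-! ## One stage -/

section Stage

variable {E : Type*} {m : ℕ} [NeZero m] (L : SetList E m)

/-- What is known after the samples have been drawn and `k` stages have been completed. -/
structure StageInv (R ρ : ℝ) (k : ℕ) (s : State E) : Prop where
  count : s.nat 0 0 = m
  draws : s.real 2 0 = R
  ratio : s.real 3 0 = ρ
  depth : s.real 4 0 = ρ ^ k
  weight : 0 ≤ s.real 5 0
  total : 0 ≤ s.real 6 0
  pending : s.pending = []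
  rounds : s.rounds = k + 1
  valid : s.Valid L (ρ ^ k)
  time : (s.time : ℝ) ≤ 1000 * (k + 1) * (R * ρ)

variable {L} {R ρ : ℝ} {k : ℕ} {s : State E}

lemma StageInv.potential_nonneg (h : StageInv L R ρ k s) : 0 ≤ s.potential L := by
  have := h.weight
  have := h.total
  unfold State.potential
  positivity

/-- The powers `ρ^k` cancel: fewer samples are kept exactly as the scans get longer. The factors `2`
absorb the rounding up, for which `ρ^k ≤ R` is needed. -/
lemma stage_time_bound {n τ : ℕ} (hρ : 1 ≤ ρ) (hR : 1 ≤ R) (hk : ρ ^ k ≤ R)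
    (hn : (n : ℝ) ≤ R / ρ ^ k + 1) (hτ : (τ : ℝ) ≤ ρ ^ (k + 1) + 1) :
    (n : ℝ) ≤ 2 * (R * ρ) ∧ (n * τ : ℝ) ≤ 4 * (R * ρ) ∧ 1 ≤ R * ρ := by
  have h1 : 1 ≤ ρ ^ k := one_le_pow₀ hρ
  have h2 : 1 ≤ ρ ^ (k + 1) := one_le_pow₀ hρ
  have h3 : 1 ≤ R / ρ ^ k := by rwa [one_le_div (by linarith)]
  have h4 : R / ρ ^ k ≤ R := div_le_self (by linarith) h1
  have h5 : R ≤ R * ρ := le_mul_of_one_le_right (by linarith) hρ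
  refine ⟨by linarith, ?_, by linarith⟩
  calc (n * τ : ℝ) ≤ (2 * (R / ρ ^ k)) * (2 * ρ ^ (k + 1)) := by
        gcongr <;> linarith
    _ = 4 * (R * ρ) := by
        rw [pow_succ]
        field_simp
        ring

/-- The error of a stage comes from the resampling only. -/
lemma stage_run (h : StageInv L R ρ k s) (hρ : 1 ≤ ρ) (hR : 1 ≤ R) (hk : ρ ^ k ≤ R)
    {η : ℝ} (hη0 : 0 < η) (hη1 : η ≤ 1) :
    Sure (Program.stage.run L s) (StageInv L R ρ (k + 1)) ∧
      Fails (Program.stage.run L s)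
        (fun a => |a.potential L - s.potential L| ≤ η * s.potential L)
        (ENNReal.ofReal (2 * Real.exp (-(η ^ 2 * (R / m) / 4)))) := by
  have hm : (0 : ℝ) < m := by exact_mod_cast NeZero.pos m
  obtain ⟨n, hn⟩ : ∃ n, ⌈s.real 2 0 / s.real 4 0 * ((s.nat 4 0 : ℝ) / s.nat 4 0)⌉₊ = n := ⟨_, rfl⟩
  obtain ⟨τ, hτ⟩ : ∃ τ, ⌈s.real 4 0 * s.real 3 0⌉₊ = τ := ⟨_, rfl⟩
  set s1 : State E := (s.putNat 13 0 0).tick 3 with hs1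
  have hrun : Program.stage.run L s =
      (Program.resample.run L s1).bind (Program.sift.run L) := by
    simp only [Program.stage, Prog.run, PMF.pure_bind]
    rfl
  have hnR : (n : ℝ) ≤ R / ρ ^ k + 1 := by
    rw [← hn, h.draws, h.depth]
    have : 0 ≤ R / ρ ^ k := by positivity
    refine (Nat.ceil_lt_add_one (by positivity)).le.trans ?_
    gcongr
    exact mul_le_of_le_one_right this (div_self_le_one _)
  have hτR : (τ : ℝ) ≤ ρ ^ (k + 1) + 1 := by
    rw [← hτ, h.depth, h.ratio, ← pow_succ]
    exact (Nat.ceil_lt_add_one (by positivity)).le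
  obtain ⟨hb1, hb2, hb3⟩ := stage_time_bound hρ hR hk hnR hτR
  have hres : Sure (Program.resample.run L s1) (ResampleInv s1 n) :=
    sure_resample L n (by simp [hs1]) (by simpa [hs1] using hn)
  have hsift : ∀ a, ResampleInv s1 n a → Sure (Program.sift.run L a) fun b =>
      StageInv L R ρ (k + 1) b ∧ b.potential L = s.real 6 0 + s.real 5 0 *
        ((s.nat 4 0 : ℝ) / n) * ∑ j ∈ Finset.range n, (s.gapAt L (a.nat 6 j) : ℝ) := by
    rintro a ⟨h1, h2, h3, h4, h5, h6, h7, h8⟩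
    have a5 : ∀ q, a.nat 5 q = s.nat 5 q := fun q => by
      rw [h1 5 q (by decide) (by decide) (by decide)]
      simp [hs1]
    have a4 : a.nat 4 0 = s.nat 4 0 := by
      rw [h1 4 0 (by decide) (by decide) (by decide)]
      simp [hs1]
    have ael : a.elem = s.elem := by simp [h3, hs1]
    have areal : a.real = s.real := by simp [h2, hs1]
    have agap : ∀ q, a.gapAt L q = s.gapAt L q := fun q => by
      rw [State.gapAt, State.gapAt, a5, ael]
    have aval : a.Valid L (ρ ^ k) := by
      intro q hq
      rw [a4] at hq
      rw [a5, ael, agap]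
      exact h.valid q hq
    refine (sure_sift L (ρ ^ k) τ n ?_ h6 ?_ ?_ ?_ aval ?_).mono ?_
    · rw [h1 0 0 (by decide) (by decide) (by decide)]
      simp [hs1, h.count]
    · simp [h4, hs1, h.pending]
    · rw [areal]
      exact h.weight
    · rw [areal]
      exact hτ
    · intro j hj
      simpa [a4, hs1] using h7 j hj
    · rintro b ⟨g1, g2, g3, g4, g5, g6, g7, g8, g9, g10, g11⟩
      rw [areal] at g2 g3 g4 g6 g9 g10
      rw [h.depth, h.ratio, ← pow_succ] at g9
      rw [a4] at g10
      simp only [agap] at g10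
      refine ⟨⟨g1, g2.trans h.draws, g3.trans h.ratio, ?_, g5, h.total.trans g6, g7, ?_, g9, ?_⟩,
        g10⟩
      · rw [g4, h.depth, h.ratio, pow_succ]
      · simp [g8, h5, hs1, h.rounds]
      · have ht : b.time ≤ s.time + 3 + 20 + n * 20 + 100 + n * (100 * τ + 150) := by
          simp [hs1] at h8
          omega
        have ht' : (b.time : ℝ) ≤ s.time + 3 + 20 + n * 20 + 100 + n * (100 * τ + 150) := by
          exact_mod_cast ht
        have := h.time
        push_cast
        nlinarith
  refine ⟨?_, ?_⟩
  · rw [hrun, sure_bind]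
    exact hres.mono fun a ha => (hsift a ha).mono fun b hb => hb.1
  · rw [hrun]
    set S := s.nat 4 0 with hS
    set G : ℝ := ∑ q ∈ Finset.range S, (s.gapAt L q : ℝ) with hG
    have hpot : s.potential L = s.real 6 0 + s.real 5 0 * G := rfl
    -- Since `R / ρ^k > 0`, no position is chosen only if the list is empty; then the potential is
    -- already the total and does not change.
    rcases Nat.eq_zero_or_pos n with rfl | hnpos
    · refine Sure.fails ?_ _
      rw [sure_bind]
      refine hres.mono fun a ha => (hsift a ha).mono fun b hb => ?_
      have hS0 : S = 0 := by
        by_contra hS0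
        have : (S : ℝ) ≠ 0 := by exact_mod_cast hS0
        rw [h.draws, h.depth, div_self this, mul_one, Nat.ceil_eq_zero] at hn
        have : 0 < R / ρ ^ k := by positivity
        linarith
      have : b.potential L = s.potential L := by
        rw [hb.2, hpot, hG, hS0]
        simp
      rw [this]
      simp only [sub_self, abs_zero]
      exact mul_nonneg hη0.le h.potential_nonneg
    · have hSpos : 0 < S := ceil_pos_imp hn hnpos
      have hSR : (0 : ℝ) < S := by exact_mod_cast hSpos
      have hnR' : (0 : ℝ) < n := by exact_mod_cast hnpos
      have hnlow : R / ρ ^ k ≤ n := by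
        rw [← hn, h.draws, h.depth, div_self hSR.ne', mul_one]
        exact Nat.le_ceil _
      have hs14 : s1.nat 4 0 = S := by simp [hs1, hS]
      have hcher := fails_resample L (s := s1) n (by simp [hs1]) (by simpa [hs1] using hn)
        (fun q => (s.gapAt L q : ℝ) / m) (fun q _ => by positivity)
        (fun q hq => by
          rw [hs14] at hq
          rw [div_le_one hm]
          exact_mod_cast (L.gap_bounds (h.valid q hq).2.1).2) hη0 hη1
      rw [hs14] at hcher
      have hGsum : ∀ t : Finset ℕ, ∀ f : ℕ → ℕ, ∑ q ∈ t, (s.gapAt L (f q) : ℝ) / m =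
          (∑ q ∈ t, (s.gapAt L (f q) : ℝ)) / m := fun t f => (Finset.sum_div _ _ _).symm
      -- The average gap is at least `ρ^k` and `n ≥ R / ρ^k`, so the Chernoff exponent is as good in
      -- every stage as in the first drawing.
      have hmean : R / m ≤ n * ((S : ℝ)⁻¹ * ∑ q ∈ Finset.range S, (s.gapAt L q : ℝ) / m) := by
        rw [hGsum _ fun q => q]
        have hGlow : S * ρ ^ k ≤ G := by
          rw [hG]
          have := Finset.card_nsmul_le_sum (Finset.range S) (fun q => (s.gapAt L q : ℝ)) (ρ ^ k)
            fun q hq => (h.valid q (Finset.mem_range.1 hq)).2.2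
          simpa using this
        have hρk : 0 < ρ ^ k := by positivity
        calc R / m = (R / ρ ^ k) * ((S : ℝ)⁻¹ * ((S * ρ ^ k) / m)) := by
              field_simp
          _ ≤ n * ((S : ℝ)⁻¹ * (G / m)) := by gcongr
      -- Given the chosen positions, the rest of the stage yields a determined potential and adds no
      -- failure probability.
      refine (Fails.bind (δ' := 0) (hcher.mono fun a _ => id) ?_).trans
        (le_of_eq_of_le (add_zero _) (ENNReal.ofReal_le_ofReal ?_))
      · intro a ha hbad
        refine ((hsift a (hres a ha)).mono fun b hb => ?_).fails 0
        rw [hGsum _ fun q => q, hGsum _ fun j => a.nat 6 j] at hbad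
        rw [hb.2, hpot]
        set X := ∑ j ∈ Finset.range n, (s.gapAt L (a.nat 6 j) : ℝ)
        have hw := h.weight
        have hdiff : s.real 6 0 + s.real 5 0 * ((S : ℝ) / n) * X - (s.real 6 0 + s.real 5 0 * G) =
            (s.real 5 0 * (S / n) * m) * (X / m - n * ((S : ℝ)⁻¹ * (G / m))) := by
          field_simp
          ring
        rw [hdiff, abs_mul, abs_of_nonneg (by positivity)]
        refine (mul_le_mul_of_nonneg_left hbad (by positivity)).trans ?_
        have : s.real 5 0 * (S / n) * m * (η * (n * ((S : ℝ)⁻¹ * (G / m)))) =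
            η * (s.real 5 0 * G) := by
          field_simp
        rw [this]
        have := h.total
        gcongr
        linarith
      · gcongr

end Stage

/-! ## Drawing the first samples -/

section Answers

variable {E : Type*} {m : ℕ} {L : SetList E m} {αL αR βL βR : ℝ}

lemma mem_of_mem_support (h : L.IsBiasedList αL αR βL βR) {i : Fin m} {x : E}
    (hx : x ∈ (L.gen i).support) : x ∈ L.set i := by
  by_contra hn
  exact ((L.gen i).mem_support_iff x).1 hx ((h i).2.2.1 x hn)

variable [NeZero m]

/-- With `μ` the mean, the factor is `(1 - μ) + e^l μ` with `0 ≤ μ ≤ 1`. -/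
lemma factor_nonneg (h : L.IsBiasedList αL αR βL βR) (l : ℝ) (i : Fin m) :
    0 ≤ 1 + (Real.exp l - 1) * L.drawMean i := by
  obtain ⟨h1, h2⟩ := drawMean_bounds h i
  have h0 : 0 ≤ L.drawMean i := le_trans (by positivity) h1
  have := mul_nonneg (Real.exp_nonneg l) h0
  linarith

/-- Requests for random elements of the sets number `I j`. -/
def elemRequests (I : ℕ → ℕ) (js : List ℕ) : List (Request E) := js.map fun j => .elem 0 j (I j)

lemma answer_elem {s : State E} {j i : ℕ} (hi : i < m) :
    answer L s (.elem 0 j i) =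
      (L.gen (Fin.ofNat m i)).map fun x => s.putElem 0 j (some x) := by
  have : (⟨i, hi⟩ : Fin m) = Fin.ofNat m i := by
    ext
    simp [Nat.mod_eq_of_lt hi]
  rw [answer, dif_pos hi, this]

lemma sure_answerAll_elem (h : L.IsBiasedList αL αR βL βR) {I : ℕ → ℕ}
    (js : List ℕ) (hI : ∀ j ∈ js, I j < m) (s : State E) :
    Sure (answerAll L (elemRequests I js) s) fun a =>
      a.nat = s.nat ∧ a.real = s.real ∧ a.pending = s.pending ∧ a.time = s.time ∧
        a.rounds = s.rounds ∧ (∀ j ∉ js, a.elem 0 j = s.elem 0 j) ∧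
        ∀ j ∈ js, L.Owner (a.elem 0 j) (Fin.ofNat m (I j)) := by
  induction js generalizing s with
  | nil =>
    rw [elemRequests, List.map_nil, answerAll, sure_pure]
    simp
  | cons i js ih =>
    rw [elemRequests, List.map_cons, answerAll, sure_bind,
      answer_elem (hI i (List.mem_cons_self ..)), sure_map]
    intro x hx
    refine (ih (fun j hj => hI j (List.mem_cons_of_mem _ hj)) _).mono ?_
    rintro a ⟨h1, h2, h3, h4, h5, h6, h7⟩
    refine ⟨h1, h2, h3, h4, h5, fun j hj => ?_, fun j hj => ?_⟩
    · rw [List.mem_cons, not_or] at hj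
      rw [h6 j hj.2]
      simp [hj.1]
    · by_cases hjs : j ∈ js
      · exact h7 j hjs
      · obtain rfl : j = i := (List.mem_cons.1 hj).resolve_right hjs
        rw [h6 j hjs]
        simpa [-Fin.ofNat_eq_cast] using (L.owner_some).2 (mem_of_mem_support h hx)

/-- Independence of the answers gives the product. The offset `c` collects the gaps already revealed
in the induction; distinct addresses guarantee that no answer is overwritten. -/
lemma pexp_answerAll_elem (h : L.IsBiasedList αL αR βL βR) {I : ℕ → ℕ} (l : ℝ)
    (js : List ℕ) (hjs : js.Nodup) (hI : ∀ j ∈ js, I j < m) (c : ℝ) (s : State E) :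
    pexp (answerAll L (elemRequests I js) s) (fun a => ENNReal.ofReal (Real.exp (l * (c +
        (js.map fun j => (L.gap (a.elem 0 j) (Fin.ofNat m (I j)) : ℝ) / m).sum)))) ≤
      ENNReal.ofReal (Real.exp (l * c) *
        (js.map fun j => 1 + (Real.exp l - 1) * L.drawMean (Fin.ofNat m (I j))).prod) := by
  have hm : (0 : ℝ) < m := by exact_mod_cast NeZero.pos m
  induction js generalizing s c with
  | nil =>
    rw [elemRequests, List.map_nil, answerAll, pexp_pure]
    simp
  | cons i js ih =>
    rw [List.nodup_cons] at hjs
    have hI' : ∀ j ∈ js, I j < m := fun j hj => hI j (List.mem_cons_of_mem _ hj)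
    rw [elemRequests, List.map_cons, answerAll, pexp_bind,
      answer_elem (hI i (List.mem_cons_self ..)), pexp_map]
    set A := Fin.ofNat m (I i) with hA
    set pr := (js.map fun j => 1 + (Real.exp l - 1) * L.drawMean (Fin.ofNat m (I j))).prod with hpr
    calc _ ≤ pexp (L.gen A) (fun x => ENNReal.ofReal (Real.exp (l * c) * pr) *
          ENNReal.ofReal (Real.exp (l * ((L.gap (some x) A : ℝ) / m)))) := by
          refine pexp_mono fun x _ => ?_
          change pexp (answerAll L (elemRequests I js) (s.putElem 0 i (some x))) _ ≤ _
          have hs := sure_answerAll_elem h js hI' (s.putElem 0 i (some x))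
          refine le_trans (pexp_mono (hs.mono ?_))
            ((ih hjs.2 hI' (c + (L.gap (some x) A : ℝ) / m) (s.putElem 0 i (some x))).trans
              (le_of_eq ?_))
          · rintro a ⟨-, -, -, -, -, h6, -⟩
            have : a.elem 0 i = some x := by
              rw [h6 i hjs.1]
              simp
            rw [List.map_cons, List.sum_cons, this, ← hA, add_assoc]
          · rw [← ENNReal.ofReal_mul' (Real.exp_nonneg _), mul_add, Real.exp_add]
            congr 1
            ring
      _ ≤ _ := by
          rw [pexp_const_mul]
          refine (mul_le_mul_right (pexp_exp_le _ (L.set A)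
            (fun x hx => ?_)
            (fun x => (L.gap (some x) A : ℝ) / m) ?_ ?_ l) _).trans ?_
          · rw [PMF.apply_eq_zero_iff]
            exact fun hx' => hx (mem_of_mem_support h hx')
          · exact fun x _ => by positivity
          · intro x hx
            rw [div_le_one hm]
            exact_mod_cast (L.gap_bounds (L.owner_some.2 hx)).2
          · have hnn : ∀ j, 0 ≤ 1 + (Real.exp l - 1) * L.drawMean (Fin.ofNat m (I j)) := by
              exact fun j => factor_nonneg h l _
            rw [← ENNReal.ofReal_mul]
            · refine ENNReal.ofReal_le_ofReal (le_of_eq ?_)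
              rw [List.map_cons, List.prod_cons, ← hpr, ← hA]
              change _ * (1 + (Real.exp l - 1) * L.drawMean A) = _
              ring
            · refine mul_nonneg (Real.exp_nonneg _) (List.prod_nonneg ?_)
              intro y hy
              obtain ⟨j, -, rfl⟩ := List.mem_map.1 hy
              exact hnn j

end Answers

/-! ### The random number of requests and its moment generating function -/

section Draw

variable {E : Type*}

/-- What is known while the first samples are requested; `c` bounds their number and `t` the
time. -/
def DrawInv (m : ℕ) (s : State E) (c t : ℕ) (a : State E) : Prop :=
  (∀ b j, b ≠ 1 → b ≠ 2 → b ≠ 3 → b ≠ 4 → b ≠ 5 → a.nat b j = s.nat b j) ∧ a.real = s.real ∧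
    a.elem = s.elem ∧ a.rounds = s.rounds ∧
    a.pending = elemRequests (a.nat 5) (List.range (a.nat 4 0)) ∧
    (∀ j < a.nat 4 0, a.nat 5 j < m) ∧ a.nat 4 0 ≤ c ∧ a.time ≤ t

variable {m : ℕ} (L : SetList E m) {αL αR βL βR : ℝ}

/-- The expected number of samples from set number `i`. -/
def State.draws (s : State E) (i : ℕ) : ℝ := s.real 2 0 * (s.real 1 i / s.real 0 2)

lemma drawBody_inv {s a : State E} {c t i k : ℕ} (hi : i < m) (h : DrawInv m s c t a)
    (h1 : a.nat 1 0 = i) :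
    Sure (Program.drawBody.run L ((a.putNat 2 0 k).tick 1)) fun b =>
      DrawInv m s (c + 1) (t + 50) b ∧ b.nat 1 0 = i := by
  obtain ⟨g1, g2, g3, g4, g5, g6, g7, g8⟩ := h
  simp only [Program.drawBody, Prog.run, sure_bind, sure_map]
  refine (sure_coinDist _).mono ?_
  rintro v (rfl | rfl)
  · rw [if_neg (by simp), sure_pure]
    refine ⟨⟨?_, ?_, ?_, ?_, ?_, ?_, ?_, ?_⟩, ?_⟩
    · intro b j b1 b2 b3 b4 b5
      simp [b2, b3, g1 b j b1 b2 b3 b4 b5]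
    · simp [g2]
    · simp [g3]
    · simp [g4]
    · simpa [Program.expectedDraws, elemRequests] using g5
    · simpa using g6
    · simp
      omega
    · simp [Program.expectedDraws]
      omega
    · simp [h1]
  · rw [if_pos (by simp)]
    simp only [sure_bind, sure_pure]
    refine ⟨⟨?_, ?_, ?_, ?_, ?_, ?_, ?_, ?_⟩, ?_⟩
    · intro b j b1 b2 b3 b4 b5
      simp [b2, b3, b4, b5, g1 b j b1 b2 b3 b4 b5]
    · simp [g2]
    · simp [g3]
    · simp [g4]
    · simp [g5, elemRequests, List.range_succ, h1]
      intro j hj hj'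
      omega
    · intro j hj
      simp at hj
      rcases hj.lt_or_eq with hj | rfl
      · simp [hj.ne, g6 j hj]
      · simp [h1, hi]
    · simp
      omega
    · simp [Program.expectedDraws]
      omega
    · simp [h1]

variable [NeZero m]

/-- The factors that the requested samples contribute to the moment generating function. -/
def drawFactor (l : ℝ) (a : State E) : ℝ :=
  ((List.range (a.nat 4 0)).map fun j =>
    1 + (Real.exp l - 1) * L.drawMean (Fin.ofNat m (a.nat 5 j))).prod

lemma drawFactor_nonneg {L : SetList E m} (h : L.IsBiasedList αL αR βL βR) (l : ℝ) (a : State E) :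
    0 ≤ drawFactor L l a := by
  refine List.prod_nonneg fun y hy => ?_
  obtain ⟨j, -, rfl⟩ := List.mem_map.1 hy
  exact factor_nonneg h l _

/-- A draw with probability `p` multiplies the factor by `1 + d`, and in expectation by `1 + p d ≤
exp (p d)`. -/
lemma pexp_drawBody {L : SetList E m} (h : L.IsBiasedList αL αR βL βR) (l : ℝ) {s a : State E}
    {c t i k : ℕ} (ha : DrawInv m s c t a) (h1 : a.nat 1 0 = i) (hk : (k : ℝ) < s.draws i) (C : ℝ) :
    pexp (Program.drawBody.run L ((a.putNat 2 0 k).tick 1))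
        (fun b => ENNReal.ofReal (drawFactor L l b * Real.exp C)) ≤
      ENNReal.ofReal (drawFactor L l a * Real.exp (C + min (s.draws i - k) 1 *
        ((Real.exp l - 1) * L.drawMean (Fin.ofNat m i)))) := by
  obtain ⟨g1, g2, g3, g4, g5, g6, g7, g8⟩ := ha
  set d := (Real.exp l - 1) * L.drawMean (Fin.ofNat m i) with hd
  have hp0 : 0 ≤ min (s.draws i - k) 1 := le_min (by linarith) zero_le_one
  have hp1 : min (s.draws i - k) 1 ≤ 1 := min_le_right _ _
  have hF := drawFactor_nonneg h l a
  have hd0 : 0 ≤ 1 + d := factor_nonneg h l _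
  have heval : RExp.eval ((a.putNat 2 0 k).tick 1)
      (Program.expectedDraws.sub (.ofNat (.get 2 Program.z))) = s.draws i - k := by
    simp [Program.expectedDraws, State.draws, g2, h1]
  simp only [Program.drawBody, Prog.run, pexp_bind, pexp_map]
  rw [heval, pexp_coinDist, if_pos (by simp), if_neg (by simp)]
  simp only [pexp_pure, pexp_bind]
  obtain ⟨F, hF'⟩ : ∃ F, drawFactor L l a = F := ⟨_, rfl⟩
  rw [hF'] at hF ⊢
  have hone : ∀ b : State E, b.nat 4 0 = a.nat 4 0 + 1 → (∀ j < a.nat 4 0, b.nat 5 j = a.nat 5 j) →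
      b.nat 5 (a.nat 4 0) = i → drawFactor L l b = F * (1 + d) := by
    intro b b4 b5 b5'
    rw [← hF']
    simp only [drawFactor]
    rw [b4, List.range_succ, List.map_append, List.prod_append, List.map_singleton,
      List.prod_singleton, b5', ← hd]
    congr 2
    refine List.map_congr_left fun j hj => ?_
    rw [b5 j (List.mem_range.1 hj)]
  have hzero : ∀ b : State E, b.nat 4 0 = a.nat 4 0 → b.nat 5 = a.nat 5 →
      drawFactor L l b = F := by
    intro b b4 b5
    rw [← hF']
    simp only [drawFactor, b4, b5]
  rw [hone _ (by simp) (fun j hj => by simp [hj.ne]) (by simp [h1]),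
    hzero _ (by simp) (by funext j; simp)]
  rw [← ENNReal.ofReal_one, ← ENNReal.ofReal_sub _ hp0, ← ENNReal.ofReal_mul hp0,
    ← ENNReal.ofReal_mul (by linarith), ← ENNReal.ofReal_add (by positivity)
      (mul_nonneg (by linarith) (by positivity))]
  refine ENNReal.ofReal_le_ofReal ?_
  calc _ = F * (Real.exp C * (min (s.draws i - k) 1 * d + 1)) := by ring
    _ ≤ _ := by
      rw [Real.exp_add]
      gcongr
      exact Real.add_one_le_exp _

lemma drawFrom_spec {L : SetList E m} (h : L.IsBiasedList αL αR βL βR) {s a : State E}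
    {c t i : ℕ} (hi : i < m) (ha : DrawInv m s c t a) (h1 : a.nat 1 0 = i)
    (hr : 0 ≤ s.draws i) :
    Sure (Program.drawFrom.run L a)
        (DrawInv m s (c + ⌈s.draws i⌉₊) (t + 20 + 50 * ⌈s.draws i⌉₊)) ∧
      ∀ l C : ℝ, pexp (Program.drawFrom.run L a)
          (fun b => ENNReal.ofReal (drawFactor L l b * Real.exp C)) ≤
        ENNReal.ofReal (drawFactor L l a * Real.exp (C + s.draws i *
          ((Real.exp l - 1) * L.drawMean (Fin.ofNat m i)))) := by
  have heval : RExp.eval a Program.expectedDraws = s.draws i := by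
    simp [Program.expectedDraws, State.draws, ha.2.1, h1]
  have h0 : DrawInv m s (c + 0) (t + 20 + 50 * 0) (a.tick (Program.expectedDraws.cost + 1)) ∧
      (a.tick (Program.expectedDraws.cost + 1)).nat 1 0 = i := by
    obtain ⟨g1, g2, g3, g4, g5, g6, g7, g8⟩ := ha
    refine ⟨⟨g1, g2, g3, g4, g5, g6, g7, ?_⟩, h1⟩
    simp [Program.expectedDraws]
    omega
  have hstep : ∀ k < ⌈s.draws i⌉₊, ∀ b : State E,
      (DrawInv m s (c + k) (t + 20 + 50 * k) b ∧ b.nat 1 0 = i) →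
      Sure (Program.drawBody.run L ((b.putNat 2 0 k).tick 1)) fun b' =>
        DrawInv m s (c + (k + 1)) (t + 20 + 50 * (k + 1)) b' ∧ b'.nat 1 0 = i :=
    fun k _ b hb => drawBody_inv L hi hb.1 hb.2
  rw [Program.drawFrom, Prog.run, heval]
  refine ⟨?_, fun l C => ?_⟩
  · exact (sure_iter (fun k b => DrawInv m s (c + k) (t + 20 + 50 * k) b ∧ b.nat 1 0 = i) _ _ h0
      hstep).mono fun b hb => hb.1
  · set d := (Real.exp l - 1) * L.drawMean (Fin.ofNat m i) with hd
    refine le_trans (le_of_eq ?_) ((pexp_iter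
      (fun k b => DrawInv m s (c + k) (t + 20 + 50 * k) b ∧ b.nat 1 0 = i)
      -- The exponent carries the expected number of draws still to come; the biases `min (d - k) 1`
      -- telescope to `d`.
      (fun k b => ENNReal.ofReal (drawFactor L l b *
        Real.exp (C + (s.draws i - min (k : ℝ) (s.draws i)) * d))) _ _ h0 hstep ?_).trans
        (le_of_eq ?_))
    · simp [min_eq_right (Nat.le_ceil (s.draws i))]
    · intro k hk b hb
      have hk' : (k : ℝ) < s.draws i := Nat.lt_ceil.1 hk
      refine (pexp_drawBody h l hb.1 hb.2 hk' _).trans (le_of_eq ?_)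
      rw [← hd, min_eq_left hk'.le]
      congr 3
      push_cast
      rcases le_total ((k : ℝ) + 1) (s.draws i) with h2 | h2
      · rw [min_eq_left h2, min_eq_right (by linarith)]
        ring
      · rw [min_eq_right h2, min_eq_left (by linarith)]
        ring
    · rw [Nat.cast_zero, min_eq_left hr, sub_zero]
      rfl

end Draw

/-! ### Concentration of the first estimate -/

section DrawAll

variable {E : Type*} {m : ℕ} [NeZero m] {L : SetList E m} {αL αR βL βR : ℝ}

lemma drawAll_spec (h : L.IsBiasedList αL αR βL βR) {s : State E} (hm : s.nat 0 0 = m)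
    (h4 : s.nat 4 0 = 0) (hp : s.pending = []) (hr : ∀ i, 0 ≤ s.draws i) :
    Sure (Program.drawAll.run L s)
        (DrawInv m s (∑ i ∈ Finset.range m, ⌈s.draws i⌉₊)
          (s.time + 10 + 30 * m + 50 * ∑ i ∈ Finset.range m, ⌈s.draws i⌉₊)) ∧
      ∀ l : ℝ, pexp (Program.drawAll.run L s) (fun b => ENNReal.ofReal (drawFactor L l b)) ≤
        ENNReal.ofReal (Real.exp ((Real.exp l - 1) *
          ∑ i ∈ Finset.range m, s.draws i * L.drawMean (Fin.ofNat m i))) := by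
  set D : ℕ → ℕ := fun k => ∑ i ∈ Finset.range k, ⌈s.draws i⌉₊ with hD
  have heval : ⌈RExp.eval s (.ofNat (.get 0 Program.z))⌉₊ = m := by simp [hm]
  have h0 : DrawInv m s (D 0) (s.time + 10 + 30 * 0 + 50 * D 0)
      (s.tick ((RExp.ofNat (.get 0 Program.z)).cost + 1)) := by
    refine ⟨fun _ _ _ _ _ _ _ => rfl, rfl, rfl, rfl, ?_, ?_, ?_, ?_⟩ <;>
      simp [h4, hp, elemRequests, hD]
  have hpass : ∀ k a, DrawInv m s (D k) (s.time + 10 + 30 * k + 50 * D k) a →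
      DrawInv m s (D k) (s.time + 10 + 30 * k + 50 * D k + 1) ((a.putNat 1 0 k).tick 1) := by
    rintro k a ⟨g1, g2, g3, g4, g5, g6, g7, g8⟩
    refine ⟨?_, g2, g3, g4, ?_, ?_, ?_, ?_⟩
    · intro b j b1 b2 b3 b4 b5
      simp [b1, g1 b j b1 b2 b3 b4 b5]
    · simpa [elemRequests] using g5
    · simpa using g6
    · simpa using g7
    · simpa using g8
  have hstep : ∀ k < m, ∀ a, DrawInv m s (D k) (s.time + 10 + 30 * k + 50 * D k) a →
      Sure (Program.drawFrom.run L ((a.putNat 1 0 k).tick 1))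
        (DrawInv m s (D (k + 1)) (s.time + 10 + 30 * (k + 1) + 50 * D (k + 1))) := by
    intro k hk a ha
    refine (drawFrom_spec h hk (hpass k a ha) (by simp) (hr k)).1.mono ?_
    rintro b ⟨g1, g2, g3, g4, g5, g6, g7, g8⟩
    have : D (k + 1) = D k + ⌈s.draws k⌉₊ := Finset.sum_range_succ _ _
    refine ⟨g1, g2, g3, g4, g5, g6, ?_, ?_⟩ <;> omega
  rw [Program.drawAll, Prog.run, heval]
  refine ⟨sure_iter (fun k a => DrawInv m s (D k) (s.time + 10 + 30 * k + 50 * D k) a) m _ h0 hstep,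
    fun l => ?_⟩
  set c : ℕ → ℝ := fun i => s.draws i * ((Real.exp l - 1) * L.drawMean (Fin.ofNat m i)) with hc
  refine le_trans (le_of_eq ?_) ((pexp_iter
    (fun k a => DrawInv m s (D k) (s.time + 10 + 30 * k + 50 * D k) a)
    (fun k b => ENNReal.ofReal (drawFactor L l b *
      Real.exp (∑ i ∈ Finset.range m, c i - ∑ i ∈ Finset.range k, c i))) m _ h0 hstep ?_).trans
      (le_of_eq ?_))
  · simp
  · intro k hk a ha
    refine ((drawFrom_spec h hk (hpass k a ha) (by simp) (hr k)).2 l _).trans (le_of_eq ?_)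
    have : drawFactor L l ((a.putNat 1 0 k).tick 1) = drawFactor L l a := by
      simp [drawFactor]
    rw [this, Finset.sum_range_succ]
    congr 3
    simp only [hc]
    ring
  · have : drawFactor L l (s.tick ((RExp.ofNat (.get 0 Program.z)).cost + 1)) = 1 := by
      simp [drawFactor, h4]
    rw [this, one_mul, Finset.range_zero, Finset.sum_empty, sub_zero, Finset.mul_sum]
    congr 2
    exact Finset.sum_congr rfl fun i _ => by simp only [hc]; ring

lemma list_sum_range (f : ℕ → ℝ) (n : ℕ) :
    ((List.range n).map f).sum = ∑ i ∈ Finset.range n, f i := by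
  induction n with
  | zero => simp
  | succ n ih => simp [List.range_succ, Finset.sum_range_succ, ih]

/-- `drawFactor` bounds the moment generating function conditioned on which sets are asked.
Averaging it over the coins with `drawAll_spec` gives the hypothesis of `fails_of_mgf`. -/
lemma round_spec (h : L.IsBiasedList αL αR βL βR) {s a : State E} {c t : ℕ}
    (ha : DrawInv m s c t a) :
    Sure (Prog.round.run L a) (fun b => b.nat = a.nat ∧ b.real = s.real ∧ b.pending = [] ∧
        b.time ≤ t + c + 1 ∧ b.rounds = s.rounds + 1 ∧
        ∀ j < b.nat 4 0, b.nat 5 j < m ∧ L.Owner (b.elem 0 j) (Fin.ofNat m (b.nat 5 j))) ∧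
      ∀ l : ℝ, pexp (Prog.round.run L a) (fun b => ENNReal.ofReal (Real.exp (l *
          ∑ j ∈ Finset.range (b.nat 4 0), (b.gapAt L j : ℝ) / m))) ≤
        ENNReal.ofReal (drawFactor L l a) := by
  obtain ⟨g1, g2, g3, g4, g5, g6, g7, g8⟩ := ha
  have hI : ∀ j ∈ List.range (a.nat 4 0), a.nat 5 j < m := fun j hj => g6 j (List.mem_range.1 hj)
  have hs := sure_answerAll_elem h (List.range (a.nat 4 0)) hI { a with
    pending := [], time := a.time + a.pending.length + 1, rounds := a.rounds + 1 }
  rw [Prog.run]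
  constructor
  · rw [g5] at hs ⊢
    refine hs.mono ?_
    rintro b ⟨f1, f2, f3, f4, f5, -, f7⟩
    refine ⟨f1, f2.trans g2, f3, ?_, ?_, ?_⟩
    · rw [f4]
      simp [elemRequests]
      omega
    · rw [f5, ← g4]
    · intro j hj
      rw [f1] at hj ⊢
      exact ⟨g6 j hj, f7 j (List.mem_range.2 hj)⟩
  · intro l
    have := pexp_answerAll_elem h l (List.range (a.nat 4 0)) List.nodup_range hI 0 { a with
      pending := [], time := a.time + a.pending.length + 1, rounds := a.rounds + 1 }
    rw [g5] at hs this ⊢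
    refine (pexp_mono (hs.mono ?_)).trans (this.trans (le_of_eq ?_))
    · rintro b ⟨f1, -, -, -, -, -, -⟩
      rw [f1, zero_add, list_sum_range]
      refine le_of_eq ?_
      simp only [State.gapAt, f1]
    · rw [mul_zero, Real.exp_zero, one_mul]
      rfl

lemma draw_run (h : L.IsBiasedList αL αR βL βR) (hβ : βL < 1) {s : State E} {R ρ : ℝ}
    (hm : s.nat 0 0 = m) (h4 : s.nat 4 0 = 0) (hp : s.pending = []) (hrounds : s.rounds = 0)
    (htime : s.time ≤ 100) (hsize : ∀ i : Fin m, s.real 1 i = L.size i)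
    (hsize' : ∀ i, m ≤ i → s.real 1 i = 0)
    (hM : s.real 0 2 = L.totalSize) (h2 : s.real 2 0 = R) (h3 : s.real 3 0 = ρ)
    (h4' : s.real 4 0 = 1) (h5 : s.real 5 0 = L.totalSize / (R * m)) (h6 : s.real 6 0 = 0)
    (hρ : 1 ≤ ρ) (hR : m ≤ R) {η : ℝ} (hη0 : 0 < η) (hη1 : η ≤ 1) :
    Sure ((Program.drawAll.run L s).bind (Prog.round.run L)) (StageInv L R ρ 0) ∧
      Fails ((Program.drawAll.run L s).bind (Prog.round.run L))
        (fun b => |b.potential L - L.mean| ≤ η * L.mean)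
        (ENNReal.ofReal (2 * Real.exp (-(η ^ 2 * (R / m) / 4)))) := by
  have hm1 : (1 : ℝ) ≤ m := by exact_mod_cast NeZero.pos m
  have hM0 := totalSize_pos h hβ
  have hR0 : 0 < R := by linarith
  have hdraws : ∀ i : Fin m, s.draws i = R / L.totalSize * L.size i := fun i => by
    rw [State.draws, h2, hsize, hM]
    ring
  have hr : ∀ i, 0 ≤ s.draws i := by
    intro i
    rcases Nat.lt_or_ge i m with hi | hi
    · have := size_pos h hβ ⟨i, hi⟩
      rw [show s.draws i = _ from hdraws ⟨i, hi⟩]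
      positivity
    · rw [State.draws, hsize' i hi]
      simp
  obtain ⟨hs, hmgf⟩ := drawAll_spec h hm h4 hp hr
  set N := ∑ i ∈ Finset.range m, ⌈s.draws i⌉₊ with hN
  -- The expected draws add up to `R`, and rounding up adds at most one per set.
  have hNR : (N : ℝ) ≤ R + m := by
    rw [hN, Nat.cast_sum]
    calc _ ≤ ∑ i ∈ Finset.range m, (s.draws i + 1) :=
          Finset.sum_le_sum fun i _ => (Nat.ceil_lt_add_one (hr i)).le
      _ = R + m := by
          rw [Finset.sum_add_distrib, Finset.sum_range]
          simp only [hdraws]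
          rw [← Finset.mul_sum]
          change R / L.totalSize * L.totalSize + _ = _
          simp [hM0.ne']
  have hsure : Sure ((Program.drawAll.run L s).bind (Prog.round.run L)) (StageInv L R ρ 0) := by
    rw [sure_bind]
    refine hs.mono fun a ha => (round_spec h ha).1.mono ?_
    rintro b ⟨f1, f2, f3, f4, f5, f6⟩
    have ht : (b.time : ℝ) ≤ s.time + 10 + 30 * m + 50 * N + N + 1 := by exact_mod_cast f4
    have hst : (s.time : ℝ) ≤ 100 := by exact_mod_cast htime
    have hRρ : R ≤ R * ρ := le_mul_of_one_le_right hR0.le hρ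
    refine ⟨?_, by rw [f2, h2], by rw [f2, h3], by rw [f2, h4', pow_zero], ?_, by rw [f2, h6],
      f3, by rw [f5, hrounds], ?_, ?_⟩
    · rw [f1, ha.1 0 0 (by decide) (by decide) (by decide) (by decide) (by decide), hm]
    · rw [f2, h5]
      positivity
    · intro j hj
      refine ⟨(f6 j hj).1, (f6 j hj).2, ?_⟩
      rw [pow_zero]
      exact_mod_cast (L.gap_bounds (f6 j hj).2).1
    · push_cast
      linarith
  refine ⟨hsure, ?_⟩
  have hmean : ∑ i ∈ Finset.range m, s.draws i * L.drawMean (Fin.ofNat m i) =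
      R / L.totalSize * L.mean := by
    rw [Finset.sum_range, SetList.mean, Finset.mul_sum]
    refine Finset.sum_congr rfl fun i _ => ?_
    rw [hdraws, ofNat_val]
    ring
  have hlow : R / m ≤ R / L.totalSize * L.mean := by
    have := le_mean h hβ
    calc R / m = R / L.totalSize * (L.totalSize / m) := by field_simp
      _ ≤ _ := by gcongr
  have hmean0 : 0 ≤ R / L.totalSize * L.mean := le_trans (by positivity) hlow
  refine ((fails_of_mgf ((Program.drawAll.run L s).bind (Prog.round.run L))
    (fun b => ∑ j ∈ Finset.range (b.nat 4 0), (b.gapAt L j : ℝ) / m) _ η hmean0 hη0 hη1 ?_).mono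
    ?_).weaken ?_
  · intro l
    rw [pexp_bind, ← hmean]
    exact (pexp_mono (hs.mono fun a ha => (round_spec h ha).2 l)).trans (hmgf l)
  · have hpot : Sure ((Program.drawAll.run L s).bind (Prog.round.run L))
        fun b => b.real 5 0 = L.totalSize / (R * m) ∧ b.real 6 0 = 0 := by
      rw [sure_bind]
      refine hs.mono fun a ha => (round_spec h ha).1.mono ?_
      rintro b ⟨f1, f2, -⟩
      rw [f2]
      exact ⟨h5, h6⟩
    refine hpot.mono ?_
    rintro b ⟨b5, b6⟩ hb
    rw [← Finset.sum_div] at hb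
    rw [State.potential, b5, b6]
    set G := ∑ j ∈ Finset.range (b.nat 4 0), (b.gapAt L j : ℝ)
    -- The potential is the sum of gap`/m` scaled by `M/R`, so the relative error carries over
    -- unchanged.
    have : 0 + L.totalSize / (R * m) * G - L.mean =
        L.totalSize / R * (G / m - R / L.totalSize * L.mean) := by
      field_simp
      ring
    rw [this, abs_mul, abs_of_nonneg (by positivity)]
    refine (mul_le_mul_of_nonneg_left hb (by positivity)).trans (le_of_eq ?_)
    field_simp
  · refine ENNReal.ofReal_le_ofReal ?_
    gcongr

end DrawAll

/-! ## The algorithm -/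

section Main

variable {E : Type*} {m : ℕ} [NeZero m] {L : SetList E m} {αL αR βL βR : ℝ}

/-- Compounds `n` relative errors `ε/(2n)`: Bernoulli's inequality below, and `exp (ε/2) ≤ 1 + ε`
above. -/
lemma pow_error {ε : ℝ} (hε0 : 0 < ε) (hε1 : ε < 1) (n : ℕ) (hn : 0 < n) :
    1 - ε ≤ (1 - ε / (2 * n)) ^ n ∧ (1 + ε / (2 * n)) ^ n ≤ 1 + ε := by
  have hn' : (1 : ℝ) ≤ n := by exact_mod_cast hn
  have hne : (n : ℝ) * (ε / (2 * n)) = ε / 2 := by field_simp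
  have hsmall : ε / (2 * n) ≤ 1 := by
    rw [div_le_one (by positivity)]
    linarith
  constructor
  · have := one_add_mul_le_pow (a := -(ε / (2 * n))) (by linarith) n
    rw [← sub_eq_add_neg] at this
    linarith
  · calc _ ≤ Real.exp (ε / (2 * n)) ^ n := by
          gcongr
          linarith [Real.add_one_le_exp (ε / (2 * n))]
      _ = Real.exp (ε / 2) := by rw [← Real.exp_nat_mul, hne]
      _ ≤ _ := by
          have := exp_sub_one_le (l := ε / 2) (by rw [abs_of_pos (by linarith)]; linarith)
          nlinarith

/-- The relative errors multiply because each stage is compared with the potential it started from;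
the failure probabilities add. -/
lemma stages_run {s : State E} {R ρ μ : ℝ} {η : ℝ} {δ : ℝ≥0∞} (hρ : 1 ≤ ρ)
    (hR : 1 ≤ R) (hη0 : 0 < η) (hη1 : η ≤ 1)
    (hδ : ENNReal.ofReal (2 * Real.exp (-(η ^ 2 * (R / m) / 4))) ≤ δ)
    (h0 : Sure ((Program.stages 0).run L s) (StageInv L R ρ 0))
    (h0' : Fails ((Program.stages 0).run L s) (fun b => |b.potential L - μ| ≤ η * μ) δ)
    (k : ℕ) (hk : ∀ j < k, ρ ^ j ≤ R) :
    Sure ((Program.stages k).run L s) (StageInv L R ρ k) ∧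
      Fails ((Program.stages k).run L s)
        (fun b => (1 - η) ^ (k + 1) * μ ≤ b.potential L ∧
          b.potential L ≤ (1 + η) ^ (k + 1) * μ) ((k + 1 : ℕ) * δ) := by
  induction k with
  | zero =>
    refine ⟨h0, (h0'.mono fun b _ hb => ?_).weaken (by simp)⟩
    rw [abs_le] at hb
    rw [zero_add, pow_one, pow_one]
    constructor <;> linarith
  | succ k ih =>
    obtain ⟨ih1, ih2⟩ := ih fun j hj => hk j (hj.trans k.lt_succ_self)
    have hstage := fun a (ha : StageInv L R ρ k a) =>
      stage_run ha hρ hR (hk k k.lt_succ_self) hη0 hη1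
    rw [Program.stages, Prog.run]
    refine ⟨sure_bind.2 (ih1.mono fun a ha => (hstage a ha).1), ?_⟩
    refine (ih2.bind (δ' := δ) fun a ha hab => ?_).weaken (le_of_eq (by push_cast; ring))
    refine ((hstage a (ih1 a ha)).2.weaken hδ).mono fun b _ hb => ?_
    rw [abs_le] at hb
    obtain ⟨l1, l2⟩ := hab
    constructor
    · calc _ = (1 - η) * ((1 - η) ^ (k + 1) * μ) := by ring
        _ ≤ (1 - η) * a.potential L := by
            gcongr
        _ ≤ _ := by linarith
    · calc _ ≤ (1 + η) * a.potential L := by linarith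
        _ ≤ (1 + η) * ((1 + η) ^ (k + 1) * μ) := by gcongr
        _ = _ := by ring

/-- The state after the computation of the parameters. -/
lemma setup_run {K : ℕ} {ε γ R : ℝ}
    (hR : R = m * (16 * ((K : ℝ) + 2) ^ 2 / (ε * ε)) * Real.log (2 * ((K : ℝ) + 2) / γ)) :
    ∃ s : State E, (Program.setup K).run L (initial L ε γ) = PMF.pure s ∧ s.nat 0 0 = m ∧
      s.nat 4 0 = 0 ∧ s.pending = [] ∧ s.rounds = 0 ∧ s.time ≤ 100 ∧
      (∀ i : Fin m, s.real 1 i = L.size i) ∧ (∀ i, m ≤ i → s.real 1 i = 0) ∧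
      s.real 0 2 = L.totalSize ∧ s.real 2 0 = R ∧ s.real 3 0 = Real.exp (Real.log m / K) ∧
      s.real 4 0 = 1 ∧ s.real 5 0 = L.totalSize / (R * m) ∧ s.real 6 0 = 0 := by
  simp only [Program.setup, Prog.run, PMF.pure_bind]
  refine ⟨_, rfl, ?_⟩
  subst hR
  simp +contextual [initial]

/-- The lower bound serves `m ≤ R`; the upper one separates the dependence on `K`, which goes into
the constant, from that on `γ`, which goes into the polynomial. -/
lemma log_bound {K : ℕ} {γ : ℝ} (hγ0 : 0 < γ) (hγ1 : γ < 1) :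
    1 / 2 ≤ Real.log (2 * ((K : ℝ) + 2) / γ) ∧
      Real.log (2 * ((K : ℝ) + 2) / γ) ≤
        (Real.log (2 * ((K : ℝ) + 2)) + 1) * (1 + Real.log (1 / γ)) := by
  have hK : (0 : ℝ) ≤ K := Nat.cast_nonneg K
  have h4 : 4 ≤ 2 * ((K : ℝ) + 2) / γ := by
    rw [le_div_iff₀ hγ0]
    nlinarith
  have hl := Real.one_sub_inv_le_log_of_pos (show (0 : ℝ) < 4 by norm_num)
  have hy : 0 ≤ Real.log (1 / γ) := Real.log_nonneg (by rw [le_div_iff₀ hγ0]; linarith)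
  have hx : 0 ≤ Real.log (2 * ((K : ℝ) + 2)) := Real.log_nonneg (by linarith)
  constructor
  · have := Real.log_le_log (by norm_num) h4
    norm_num at hl
    linarith
  · rw [div_eq_mul_one_div, Real.log_mul (by positivity) (by positivity)]
    nlinarith

lemma main_run (hL : L.IsBiasedList αL αR βL βR) (hβ : βL < 1)
    (hm : 2 ≤ m) {K : ℕ} (hK : 1 ≤ K) {ε γ R : ℝ} (hε0 : 0 < ε) (hε1 : ε < 1) (hγ0 : 0 < γ)
    (hγ1 : γ < 1)
    (hR : R = m * (16 * ((K : ℝ) + 2) ^ 2 / (ε * ε)) * Real.log (2 * ((K : ℝ) + 2) / γ)) :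
    Sure ((Program.main K).final L ε γ) (fun a =>
        (a.time : ℝ) ≤ 1010 * (K + 2) * (R * Real.exp (Real.log m / K)) ∧ a.rounds = K + 2) ∧
      Fails ((Program.main K).final L ε γ) (fun a =>
        (1 - ε) * L.mean ≤ a.output ∧ a.output ≤ (1 + ε) * L.mean) (ENNReal.ofReal γ) := by
  have hm2 : (2 : ℝ) ≤ m := by exact_mod_cast hm
  have hK1 : (1 : ℝ) ≤ K := by exact_mod_cast hK
  have hlog := (log_bound (K := K) hγ0 hγ1).1
  set ρ := Real.exp (Real.log m / K) with hρdef
  have hlogm : 0 < Real.log m := Real.log_pos (by linarith)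
  have hρ1 : 1 < ρ := Real.one_lt_exp_iff.2 (by positivity)
  have hρK : ρ ^ K = m := by
    rw [hρdef, ← Real.exp_nat_mul, mul_div_cancel₀ _ (by positivity), Real.exp_log (by positivity)]
  have hbig : 16 ≤ 16 * ((K : ℝ) + 2) ^ 2 / (ε * ε) := by
    rw [le_div_iff₀ (by positivity)]
    nlinarith
  have hRm : m ≤ R := by
    rw [hR, mul_assoc]
    refine le_mul_of_one_le_right (by positivity) ?_
    nlinarith
  set η := ε / (2 * ((K + 2 : ℕ) : ℝ)) with hη
  have hη0 : 0 < η := by positivity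
  have hη1 : η ≤ 1 := by
    rw [hη, div_le_one (by positivity)]
    push_cast
    linarith
  have hδ : 2 * Real.exp (-(η ^ 2 * (R / m) / 4)) = γ / ((K + 2 : ℕ) : ℝ) := by
    have : η ^ 2 * (R / m) / 4 = Real.log (2 * ((K : ℝ) + 2) / γ) := by
      rw [hη, hR]
      push_cast
      field_simp
      ring
    rw [this, Real.exp_neg, Real.exp_log (by positivity)]
    push_cast
    field_simp
  obtain ⟨s, hs, s1, s2, s3, s4, s5, s6, s7, s8, s9, s10, s11, s12, s13⟩ :=
    setup_run (E := E) (L := L) hR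
  have hdraw := draw_run hL hβ s1 s2 s3 s4 s5 s6 s7 s8 s9 s10 s11 s12 s13 hρ1.le hRm hη0 hη1
  have hzero : (Program.stages 0).run L s =
      (Program.drawAll.run L s).bind (Prog.round.run L) := by
    rw [Program.stages, Prog.run]
  rw [← hzero] at hdraw
  have hmean : 0 ≤ L.mean :=
    le_trans (div_nonneg (totalSize_pos hL hβ).le (by positivity)) (le_mean hL hβ)
  obtain ⟨hsure, hfail⟩ := stages_run hρ1.le (by linarith) hη0 hη1 le_rfl hdraw.1 hdraw.2
    -- For all stages `j ≤ K` one has `ρ^j ≤ ρ^K = m ≤ R`.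
    (K + 1) fun j hj => (pow_le_pow_right₀ hρ1.le (Nat.lt_succ_iff.1 hj)).trans (by rwa [hρK])
  have hfinal : (Program.main K).final L ε γ = ((Program.stages (K + 1)).run L s).map fun a =>
      (a.putReal 0 0 (a.real 6 0)).tick 4 := by
    rw [Prog.final, Program.main, Prog.run, hs, PMF.pure_bind, ← PMF.bind_pure_comp, Prog.run]
    rfl
  -- The invariant bounds surviving gaps only by `≥`, and a gap may equal `m = ρ^K`. The stage
  -- number `K + 1` raises the bound to `mρ > m`, so the list must be empty.
  have hout : ∀ a, StageInv L R ρ (K + 1) a → a.potential L = a.real 6 0 := by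
    intro a ha
    have : a.nat 4 0 = 0 := by
      by_contra hne
      obtain ⟨_, h1, h2⟩ := ha.valid 0 (Nat.pos_of_ne_zero hne)
      have h3 : (a.gapAt L 0 : ℝ) ≤ m := by exact_mod_cast (L.gap_bounds h1).2
      rw [pow_succ, hρK] at h2
      nlinarith
    rw [State.potential, this]
    simp
  rw [hfinal]
  constructor
  · rw [sure_map]
    refine hsure.mono fun a ha => ⟨?_, ?_⟩
    · have := ha.time
      have h1 : 1 ≤ R * ρ := by nlinarith
      simp only [State.tick, State.putReal]
      push_cast at this ⊢
      nlinarith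
    · simp [ha.rounds]
  · refine fails_map ((hfail.mono fun a ha hab => ?_).weaken ?_)
    · rw [hout a (hsure a ha)] at hab
      obtain ⟨p1, p2⟩ := pow_error hε0 hε1 (K + 2) (by omega)
      have : (State.output ((a.putReal 0 0 (a.real 6 0)).tick 4)) = a.real 6 0 := by
        simp [State.output]
      rw [this]
      exact ⟨(mul_le_mul_of_nonneg_right p1 hmean).trans hab.1,
        hab.2.trans (mul_le_mul_of_nonneg_right p2 hmean)⟩
    · rw [hδ, ← ENNReal.ofReal_natCast, ← ENNReal.ofReal_mul (by positivity)]
      refine ENNReal.ofReal_le_ofReal (le_of_eq ?_)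
      push_cast
      field_simp
      ring

end Main

end SetUnion

end

/-! ### Choice of the number of stages and of the constants -/

theorem mainTheorem3 :
    ∃ (P : MvPolynomial (Fin 2) ℝ) (B : ℝ), ∀ ξ : ℝ, 0 < ξ →
      ∃ (c : SetUnion.Prog) (C : ℝ),
        ∀ (E : Type*) (m : ℕ) (L : SetUnion.SetList E m) (αL αR βL βR ε γ : ℝ),
          2 ≤ m →
          αL ∈ Set.Ico (0 : ℝ) 1 → αR ∈ Set.Ico (0 : ℝ) 1 →
          βL ∈ Set.Ico (0 : ℝ) 1 → βR ∈ Set.Ico (0 : ℝ) 1 →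
          L.IsBiasedList αL αR βL βR →
          ε ∈ Set.Ioo (0 : ℝ) 1 → γ ∈ Set.Ioo (0 : ℝ) 1 →
          (∀ s ∈ (c.final L ε γ).support,
            (s.time : ℝ) ≤
                C * MvPolynomial.eval ![1 / ε, Real.log (1 / γ)] P * (m : ℝ) ^ (1 + ξ) ∧
              (s.rounds : ℝ) ≤ B * max 1 (1 / ξ)) ∧
          ENNReal.ofReal (1 - γ) ≤
            (c.final L ε γ).toOuterMeasure
              {s | (1 - ε) * (1 - αL) * (1 - βL) * (L.unionSize : ℝ) ≤ s.output ∧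
                s.output ≤ (1 + ε) * (1 + αR) * (1 + βR) * (L.unionSize : ℝ)} := by
  -- `R` grows like `ε⁻² (1 + log (1/γ))`. There are `K + 2 < 1/ξ + 3 ≤ 4 max(1, 1/ξ)` rounds.
  refine ⟨MvPolynomial.X 0 ^ 2 * (1 + MvPolynomial.X 1), 4, fun ξ hξ => ?_⟩
  set K := ⌈1 / ξ⌉₊ with hKdef
  have hK : 1 ≤ K := Nat.one_le_ceil_iff.2 (by positivity)
  refine ⟨SetUnion.Program.main K, 1010 * (K + 2) * (16 * ((K : ℝ) + 2) ^ 2) *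
    (Real.log (2 * ((K : ℝ) + 2)) + 1), ?_⟩
  intro E m L αL αR βL βR ε γ hm hαL hαR hβL hβR hL hε hγ
  have : NeZero m := ⟨by omega⟩
  have hm2 : (2 : ℝ) ≤ m := by exact_mod_cast hm
  have hK1 : (1 : ℝ) ≤ K := by exact_mod_cast hK
  obtain ⟨hsure, hfail⟩ := SetUnion.main_run hL hβL.2 hm hK hε.1 hε.2 hγ.1 hγ.2 rfl
  obtain ⟨hlow, hup⟩ := SetUnion.mean_bounds hL hαL.2 hβL.2 hβR.1
  refine ⟨fun s hs => ?_, ?_⟩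
  · obtain ⟨ht, hr⟩ := hsure s hs
    constructor
    · refine ht.trans ?_
      have hlog := (SetUnion.log_bound (K := K) hγ.1 hγ.2).2
      have hlog0 := (SetUnion.log_bound (K := K) hγ.1 hγ.2).1
      -- `ρ = m^(1/K)` and `K ≥ 1/ξ`; together with the factor `m` in `R` this gives the exponent `1
      -- + ξ`.
      have hρ : Real.exp (Real.log m / K) ≤ (m : ℝ) ^ ξ := by
        rw [Real.rpow_def_of_pos (by linarith), div_eq_mul_inv]
        have h1 : (K : ℝ)⁻¹ ≤ ξ := by
          rw [inv_le_comm₀ (by linarith) hξ, ← one_div]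
          exact Nat.le_ceil _
        have h2 : 0 ≤ Real.log m := Real.log_nonneg (by linarith)
        gcongr
      have hε0 := hε.1
      rw [Real.rpow_add (by linarith), Real.rpow_one]
      simp only [map_mul, map_pow, map_add, map_one, MvPolynomial.eval_X, Matrix.cons_val_zero,
        Matrix.cons_val_one]
      calc _ ≤ 1010 * ((K : ℝ) + 2) * (m * (16 * ((K : ℝ) + 2) ^ 2 / (ε * ε)) *
            ((Real.log (2 * ((K : ℝ) + 2)) + 1) * (1 + Real.log (1 / γ))) * (m : ℝ) ^ ξ) := by
            have h0 : 0 ≤ m * (16 * ((K : ℝ) + 2) ^ 2 / (ε * ε)) := by positivity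
            have h1 := mul_le_mul_of_nonneg_left hlog h0
            have h2 := mul_nonneg h0 (le_trans (by norm_num) hlog0)
            exact mul_le_mul_of_nonneg_left
              (mul_le_mul h1 hρ (Real.exp_nonneg _) (h2.trans h1)) (by positivity)
        _ = _ := by
            field_simp
    · rw [hr]
      have h1 : (K : ℝ) < 1 / ξ + 1 := Nat.ceil_lt_add_one (by positivity)
      have h2 := le_max_left 1 (1 / ξ)
      have h3 := le_max_right 1 (1 / ξ)
      push_cast
      linarith
  · rw [ENNReal.ofReal_sub _ hγ.1.le, ENNReal.ofReal_one]
    refine (SetUnion.one_sub_le_of_fails hfail).trans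
      (MeasureTheory.measure_mono fun s hs => ?_)
    obtain ⟨h1, h2⟩ := hs
    have hε1 : 0 ≤ 1 - ε := by linarith [hε.2]
    have hε2 : 0 ≤ 1 + ε := by linarith [hε.1]
    constructor
    · refine le_trans ?_ h1
      rw [mul_assoc (1 - ε), mul_assoc (1 - ε)]
      gcongr
    · refine h2.trans ?_
      rw [mul_assoc (1 + ε), mul_assoc (1 + ε)]
      gcongr
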